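/- All graphs are finite and simple. The spectral radius of a graph is the spectral radius (equivalently, the largest eigenvalue) of its adjacency matrix. For a graph $F$ and $n \in \mathbb{N}$, let $\mathrm{SPEX}(n,F)$ be the set of those $n$-vertex graphs that contain no (not necessarily induced) subgraph isomorphic to $F$ and whose spectral radius is maximum among all such graphs. Write $\mathrm{SPEX}(n,F)=K_{k,n-k}$ if, up to isomorphism, the complete bipartite graph $K_{k,n-k}$ is the unique member of $\mathrm{SPEX}(n,F)$. For $m\ge 1$, let $\mathcal{T}_m$ be the set of all labelled $m$-vertex trees, that is, all trees with vertex set $\{1,\dots,m\}$. **Proposition 1.4 (counting trees).** Let $\mathcal{G}_m$ be the set of those $T\in\mathcal{T}_m$ for which there are integers $k\ge 0$ and $n_0$ such that $\mathrm{SPEX}(n,T)=K_{k,n-k}$ for all $n\ge n_0$. Then $$\lim_{m\to\infty}\frac{|\mathcal{G}_m|}{|\mathcal{T}_m|}=1 .$$ -/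

import Mathlib

/-- The spectral radius of (the adjacency matrix of) a graph. The adjacency matrix is a real
symmetric matrix, so its whole spectrum is real and taking the spectrum over `ℝ` loses nothing. -/
noncomputable def SimpleGraph.adjSpectralRadius {V : Type*} [Fintype V] [DecidableEq V]
    (G : SimpleGraph V) : ENNReal :=
  open Classical in spectralRadius ℝ (G.adjMatrix ℝ)

/-- `SPEX(n, F)`: the graphs on `n` (labelled) vertices that have no subgraph isomorphic to `F`
(induced or not) and whose spectral radius is maximum among all such graphs. -/
def SPEX {W : Type*} (n : ℕ) (F : SimpleGraph W) : Set (SimpleGraph (Fin n)) :=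
  {G | F.Free G ∧
    ∀ G' : SimpleGraph (Fin n), F.Free G' → G'.adjSpectralRadius ≤ G.adjSpectralRadius}

/-- `SPEX(n, F) = K_{k, n-k}`: up to isomorphism, the complete bipartite graph `K_{k, n-k}` is the
one and only member of `SPEX(n, F)`. -/
def SPEXEqCompleteBipartite {W : Type*} (n : ℕ) (F : SimpleGraph W) (k : ℕ) : Prop :=
  k ≤ n ∧ ∀ G : SimpleGraph (Fin n),
    G ∈ SPEX n F ↔ Nonempty (G ≃g completeBipartiteGraph (Fin k) (Fin (n - k)))

/-- The labelled trees on `m` vertices: all trees with vertex set `Fin m`. -/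
def labelledTrees (m : ℕ) : Set (SimpleGraph (Fin m)) :=
  {T | T.IsTree}

/-- The labelled trees `T` on `m` vertices such that, for some `k`, `SPEX(n, T) = K_{k, n-k}` for
all sufficiently large `n`. -/
def goodLabelledTrees (m : ℕ) : Set (SimpleGraph (Fin m)) :=
  {T | T ∈ labelledTrees m ∧ ∃ k : ℕ, ∃ n₀ : ℕ, ∀ n : ℕ, n₀ ≤ n → SPEXEqCompleteBipartite n T k}

/-! The limit rests on two facts. First, let `T` be a tree with a vertex `v` of degree three, two of
whose neighbours `a`, `b` are leaves (a pendant cherry), and suppose that the colour class `A`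
containing `a` and `b` has at most half of the vertices. Then `T` is good with `k = #A - 1`. Second,
almost every labelled tree has such cherries centred in both colour classes, so one of them serves
whichever class is the smaller.

For the first fact, `K_{k,n-k}` avoids `T` because both colour classes have more than `k` vertices.
Conversely, let `G` avoid `T` and have spectral radius at least `√(k(n-k))`. Avoiding a tree makes
`G` degenerate, and counting two-step walks weighted by the Perron vector produces a set `L` of `k`
vertices of weight near 1 and nearly full degree (`exists_dominating_set`). Let `N` be the common
neighbourhood of `L`. An edge from `N` to a vertex outside `L` would host the pendant edge `av`, and
an edge inside `L` would host `uv` with `a`, `b` placed in `N`; either completes a copy of `T`. The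
few remaining vertices are light and each misses a vertex of `L`, so comparison with the quadratic
form of `K_{k,n-k}` kills their weight, and the resulting value of `r ^ 2` shows that there are none
(`IsPerron.isBicliqueOn`).

For the second fact, trees correspond to parent maps towards a fixed root, and two switchings are
counted. At least half of the vertices have at most one child; uprooting three of them and
replanting them as a cherry offers about `m^4` choices, while undoing this in a tree with `O(τ)`
cherries takes only `O(τ m^3)` data. With `τ = m / K` this makes trees with fewer than `τ` cherries
an `O(1/K)` proportion (`card_few_cherries_mul_le`). If there are at least `τ` cherries, all centred
at depths of one parity, hanging one of them from a vertex of that parity creates at most four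
centres of the other parity: about `τ^2` choices against `4m` inverses
(`card_monochromatic_mul_le`). -/

/-! ### Perron vectors and the spectral radius. -/

open scoped Classical in
theorem SimpleGraph.abs_quadForm_le_quadForm_abs {V : Type*} [Fintype V] (G : SimpleGraph V)
    (y : V → ℝ) :
    |y ⬝ᵥ (G.adjMatrix ℝ).mulVec y| ≤
      (fun v => |y v|) ⬝ᵥ (G.adjMatrix ℝ).mulVec (fun v => |y v|) := by
  simp only [dotProduct, SimpleGraph.adjMatrix_mulVec_apply]
  refine (Finset.abs_sum_le_sum_abs _ _).trans (Finset.sum_le_sum fun v _ => ?_)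
  rw [abs_mul]
  exact mul_le_mul_of_nonneg_left (Finset.abs_sum_le_sum_abs _ _) (abs_nonneg _)

theorem Matrix.mem_spectrum_real_iff {V : Type*} [Fintype V] [DecidableEq V]
    (A : Matrix V V ℝ) (c : ℝ) :
    c ∈ spectrum ℝ A ↔ ∃ y : V → ℝ, y ≠ 0 ∧ A.mulVec y = c • y := by
  rw [← Matrix.spectrum_toLin', ← Module.End.hasEigenvalue_iff_mem_spectrum]
  constructor
  · intro h
    obtain ⟨y, hy⟩ := h.exists_hasEigenvector
    exact ⟨y, hy.2, by simpa using hy.apply_eq_smul⟩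
  · rintro ⟨y, hy0, hy⟩
    exact Module.End.hasEigenvalue_of_hasEigenvector (x := y)
      ⟨Module.End.mem_eigenspace_iff.2 (by simpa using hy), hy0⟩

/-- The quadratic form of a real symmetric matrix attains its maximum on the unit sphere. -/
theorem Matrix.exists_isMaxOn_quadForm {V : Type*} [Fintype V] [Nonempty V] (A : Matrix V V ℝ) :
    ∃ x : V → ℝ, x ⬝ᵥ x = 1 ∧ ∀ y : V → ℝ, y ⬝ᵥ A.mulVec y ≤ (x ⬝ᵥ A.mulVec x) * (y ⬝ᵥ y) := by
  classical
  let S : Set (V → ℝ) := {x | x ⬝ᵥ x = 1}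
  have hdot : Continuous fun x : V → ℝ => x ⬝ᵥ x := by
    simp only [dotProduct]; fun_prop
  have hq : Continuous fun x : V → ℝ => x ⬝ᵥ A.mulVec x := by
    simp only [dotProduct, Matrix.mulVec]; fun_prop
  have hclosed : IsClosed S := isClosed_eq hdot continuous_const
  have hsub : S ⊆ Metric.closedBall 0 1 := by
    intro x hx
    rw [mem_closedBall_zero_iff, pi_norm_le_iff_of_nonneg zero_le_one]
    intro v
    have h1 : x v * x v ≤ x ⬝ᵥ x :=
      Finset.single_le_sum (f := fun v => x v * x v) (fun i _ => mul_self_nonneg _)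
        (Finset.mem_univ v)
    rw [show x ⬝ᵥ x = 1 from hx] at h1
    rw [Real.norm_eq_abs]
    exact abs_le_one_iff_mul_self_le_one.2 h1
  have hcomp : IsCompact S := (isCompact_closedBall (0 : V → ℝ) 1).of_isClosed_subset hclosed hsub
  have hne : S.Nonempty := by
    obtain ⟨v⟩ := ‹Nonempty V›
    exact ⟨Pi.single v 1, by simp [S]⟩
  obtain ⟨x, hxS, hx⟩ := hcomp.exists_isMaxOn hne hq.continuousOn
  refine ⟨x, hxS, fun y => ?_⟩
  by_cases hy : y = 0
  · simp [hy]
  have hpos : 0 < y ⬝ᵥ y := by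
    rcases (Finset.sum_nonneg fun i (_ : i ∈ Finset.univ) => mul_self_nonneg (y i)).lt_or_eq with h | h
    · exact h
    · exact absurd (dotProduct_self_eq_zero.1 h.symm) hy
  set c := Real.sqrt (y ⬝ᵥ y)
  have hc : 0 < c := Real.sqrt_pos.2 hpos
  have hcc : c * c = y ⬝ᵥ y := Real.mul_self_sqrt hpos.le
  have hm : (c⁻¹ • y) ∈ S := by
    change (c⁻¹ • y) ⬝ᵥ (c⁻¹ • y) = 1
    rw [smul_dotProduct, dotProduct_smul, ← hcc]
    simp only [smul_eq_mul]
    field_simp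
  have := hx hm
  simp only [Set.mem_ofPred_eq, Matrix.mulVec_smul, smul_dotProduct, dotProduct_smul,
    smul_eq_mul] at this
  rw [← hcc]
  calc y ⬝ᵥ A.mulVec y = (c * c) * (c⁻¹ * (c⁻¹ * (y ⬝ᵥ A.mulVec y))) := by field_simp
    _ ≤ (c * c) * (x ⬝ᵥ A.mulVec x) := by gcongr
    _ = _ := by ring

open scoped Classical in
/-- Perron: the spectral radius of a graph is an eigenvalue with a nonnegative eigenvector. -/
theorem SimpleGraph.exists_nonneg_eigenvector {V : Type*} [Fintype V] [DecidableEq V] [Nonempty V]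
    (G : SimpleGraph V) :
    ∃ (r : ℝ) (x : V → ℝ), 0 ≤ r ∧ (∀ v, 0 ≤ x v) ∧ x ≠ 0 ∧
      (∀ v, ∑ u ∈ G.neighborFinset v, x u = r * x v) ∧
      G.adjSpectralRadius = ENNReal.ofReal r := by
  set A := G.adjMatrix ℝ with hA
  obtain ⟨x, hx1, hx⟩ := A.exists_isMaxOn_quadForm
  set r := x ⬝ᵥ A.mulVec x with hr
  set z : V → ℝ := fun v => |x v| with hz
  have hz1 : z ⬝ᵥ z = 1 := by
    rw [← hx1]; simp [dotProduct, hz, abs_mul_abs_self]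
  have hrz : r = z ⬝ᵥ A.mulVec z := by
    apply le_antisymm
    · exact (le_abs_self _).trans (G.abs_quadForm_le_quadForm_abs x)
    · simpa [hz1] using hx z
  have hr0 : 0 ≤ r := (abs_nonneg _).trans ((G.abs_quadForm_le_quadForm_abs x).trans hrz.ge)
  have hsymm : A.IsHermitian := by
    rw [Matrix.IsHermitian, Matrix.conjTranspose_eq_transpose_of_trivial]
    exact G.transpose_adjMatrix
  have hpsd : (r • (1 : Matrix V V ℝ) - A).PosSemidef := by
    refine Matrix.PosSemidef.of_dotProduct_mulVec_nonneg ?_ ?_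
    · refine Matrix.IsHermitian.sub ?_ hsymm
      simp [Matrix.IsHermitian]
    · intro y
      simp only [star_trivial, Matrix.sub_mulVec, Matrix.smul_mulVec, Matrix.one_mulVec,
        dotProduct_sub, dotProduct_smul, smul_eq_mul, sub_nonneg]
      exact hx y
  -- Since `r • 1 - A` is positive semidefinite, a vector on which its form vanishes lies in its
  -- kernel.
  have heig : A.mulVec z = r • z := by
    have := (hpsd.dotProduct_mulVec_zero_iff z).1 (by
      simp only [star_trivial, Matrix.sub_mulVec, Matrix.smul_mulVec, Matrix.one_mulVec,
        dotProduct_sub, dotProduct_smul, smul_eq_mul, hz1, ← hrz]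
      ring)
    simp only [Matrix.sub_mulVec, Matrix.smul_mulVec, Matrix.one_mulVec, sub_eq_zero] at this
    exact this.symm
  have hz0 : z ≠ 0 := by
    intro h; rw [h] at hz1; simp at hz1
  refine ⟨r, z, hr0, fun v => abs_nonneg _, hz0, fun v => ?_, ?_⟩
  · have := congrFun heig v
    rwa [SimpleGraph.adjMatrix_mulVec_apply] at this
  · rw [SimpleGraph.adjSpectralRadius, spectralRadius]
    apply le_antisymm
    · refine iSup₂_le fun c hc => ?_
      obtain ⟨y, hy0, hy⟩ := (Matrix.mem_spectrum_real_iff _ _).1 hc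
      have hpos : 0 < y ⬝ᵥ y := by
        rcases (Finset.sum_nonneg fun i (_ : i ∈ Finset.univ) =>
          mul_self_nonneg (y i)).lt_or_eq with h | h
        · exact h
        · exact absurd (dotProduct_self_eq_zero.1 h.symm) hy0
      have h1 := G.abs_quadForm_le_quadForm_abs y
      have h2 := hx (fun v => |y v|)
      have h3 : (fun v => |y v|) ⬝ᵥ (fun v => |y v|) = y ⬝ᵥ y := by
        simp [dotProduct, abs_mul_abs_self]
      rw [h3] at h2
      have h4 : |c| * (y ⬝ᵥ y) ≤ r * (y ⬝ᵥ y) := by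
        refine le_trans (le_of_eq ?_) (h1.trans h2)
        have hy' : (G.adjMatrix ℝ).mulVec y = c • y := hy
        rw [hy', dotProduct_smul, smul_eq_mul, abs_mul, abs_of_pos hpos]
      have h5 : |c| ≤ r := le_of_mul_le_mul_right h4 hpos
      rw [← Real.norm_eq_abs] at h5
      calc (‖c‖₊ : ENNReal) = ENNReal.ofReal ‖c‖ := by
              rw [ofReal_norm]; rfl
        _ ≤ _ := ENNReal.ofReal_le_ofReal h5
    · have hm : r ∈ spectrum ℝ A := (Matrix.mem_spectrum_real_iff _ _).2 ⟨z, hz0, heig⟩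
      calc ENNReal.ofReal r = (‖r‖₊ : ENNReal) := by
              rw [← Real.norm_of_nonneg hr0, ofReal_norm, Real.norm_of_nonneg hr0]; rfl
        _ ≤ _ := le_iSup₂ (f := fun k (_ : k ∈ spectrum ℝ A) => (‖k‖₊ : ENNReal)) r hm

open scoped Classical in
/-- An eigenvalue of the adjacency matrix is bounded by the spectral radius. -/
theorem SimpleGraph.ofReal_le_adjSpectralRadius {V : Type*} [Fintype V] [DecidableEq V]
    (G : SimpleGraph V) {r : ℝ} (hr : 0 ≤ r) {y : V → ℝ} (hy0 : y ≠ 0)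
    (hy : ∀ v, ∑ u ∈ G.neighborFinset v, y u = r * y v) :
    ENNReal.ofReal r ≤ G.adjSpectralRadius := by
  rw [SimpleGraph.adjSpectralRadius, spectralRadius]
  have hm : r ∈ spectrum ℝ (G.adjMatrix ℝ) := (Matrix.mem_spectrum_real_iff _ _).2
    ⟨y, hy0, by ext v; rw [SimpleGraph.adjMatrix_mulVec_apply, hy]; rfl⟩
  calc ENNReal.ofReal r = (‖r‖₊ : ENNReal) := by
          rw [← Real.norm_of_nonneg hr, ofReal_norm, Real.norm_of_nonneg hr]; rfl
    _ ≤ _ := le_iSup₂ (f := fun k (_ : k ∈ spectrum ℝ (G.adjMatrix ℝ)) => (‖k‖₊ : ENNReal)) r hm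

/-! ### Greedy embedding of trees and degeneracy. -/

open Finset

namespace SimpleGraph

theorem isContained_of_injective {W V : Type*} {T : SimpleGraph W} {G : SimpleGraph V} (φ : W → V)
    (hinj : Function.Injective φ) (hadj : ∀ x y, T.Adj x y → G.Adj (φ x) (φ y)) : T ⊑ G :=
  ⟨⟨⟨φ, fun {x y} h => hadj x y h⟩, hinj⟩⟩

open scoped Classical in
/-- A tree embeds greedily into a graph with large minimum degree. -/
theorem IsTree.exists_embedding_of_le_degree {V : Type*} [Fintype V] (G : SimpleGraph V)
    (U : Finset V) (hU : U.Nonempty) (D : ℕ) (hD : ∀ w ∈ U, D ≤ #(G.neighborFinset w ∩ U)) :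
    ∀ (n : ℕ) (W : Type*) [Fintype W] (T : SimpleGraph W), T.IsTree → Fintype.card W = n → n ≤ D →
      ∃ φ : W → V, Function.Injective φ ∧ (∀ x, φ x ∈ U) ∧
        ∀ x y, T.Adj x y → G.Adj (φ x) (φ y) := by
  intro n
  induction n with
  | zero =>
    intro W _ T hT hc _
    have := hT.1.nonempty
    exact absurd hc Fintype.card_ne_zero
  | succ n ih =>
    intro W _ T hT hc hn
    rcases subsingleton_or_nontrivial W with hs | hnt
    · obtain ⟨w, hw⟩ := hU
      exact ⟨fun _ => w, fun x y _ => Subsingleton.elim x y, fun _ => hw,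
        fun x y h => absurd (Subsingleton.elim x y) h.ne⟩
    · obtain ⟨v, hv⟩ := hT.exists_vert_degree_one_of_nontrivial
      have hconn := hT.1.induce_compl_singleton_of_degree_eq_one hv
      have hT' : (T.induce ({v}ᶜ : Set W)).IsTree := ⟨hconn, hT.2.induce _⟩
      have hcard : Fintype.card (({v}ᶜ : Set W) : Type _) = n := by
        rw [Fintype.card_compl_set, hc]; simp
      obtain ⟨φ, hφ, hφU, hφa⟩ := ih _ _ hT' hcard (by omega)
      obtain ⟨p, hp⟩ := Finset.card_eq_one.1 ((T.card_neighborFinset_eq_degree v).trans hv)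
      have hvp : ∀ y, T.Adj v y ↔ y = p := fun y => by
        rw [← mem_neighborFinset, hp, mem_singleton]
      have hpv : p ≠ v := ((hvp p).2 rfl).ne'
      -- Only `n < D` vertices are occupied, so the image of the leaf's neighbour `p` has a free
      -- neighbour in `U`.
      have hlt : #(univ.image φ) < #(G.neighborFinset (φ ⟨p, hpv⟩) ∩ U) := by
        refine lt_of_lt_of_le ?_ (hD _ (hφU _))
        rw [card_image_of_injective _ hφ, card_univ, hcard]; omega
      obtain ⟨w, hw, hwn⟩ := exists_mem_notMem_of_card_lt_card hlt
      rw [mem_inter, mem_neighborFinset] at hw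
      have hwφ : ∀ x, φ x ≠ w := fun x h => hwn (mem_image.2 ⟨x, mem_univ _, h⟩)
      refine ⟨fun x => if h : x = v then w else φ ⟨x, h⟩, ?_, ?_, ?_⟩
      · intro x y hxy
        by_cases hx : x = v <;> by_cases hy : y = v <;> simp only [hx, hy, dite_true, dite_false] at hxy
        · rw [hx, hy]
        · exact absurd hxy.symm (hwφ _)
        · exact absurd hxy (hwφ _)
        · exact congrArg Subtype.val (hφ hxy)
      · intro x
        by_cases hx : x = v <;> simp [hx, hw.2, hφU]
      · intro x y hxy
        by_cases hx : x = v <;> by_cases hy : y = v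
        · exact absurd (hx.trans hy.symm) hxy.ne
        · subst hx
          obtain rfl := (hvp y).1 hxy
          simp only [hy, dite_true, dite_false]
          exact hw.1.symm
        · subst hy
          obtain rfl := (hvp x).1 hxy.symm
          simp only [hx, dite_true, dite_false]
          exact hw.1
        · simp only [hx, hy, dite_false]
          exact hφa _ _ hxy

open scoped Classical in
/-- A graph without a given tree on `D` vertices is `D`-degenerate: a weighted edge count. -/
theorem IsTree.sum_mul_le_of_free {W V : Type*} [Fintype W] [Fintype V] {T : SimpleGraph W}
    {G : SimpleGraph V} (hT : T.IsTree) (hfree : T.Free G) {c : ℝ} (x : V → ℝ)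
    (h0 : ∀ v, 0 ≤ x v) (U : Finset V) (hx : ∀ v ∈ U, x v ≤ c) :
    ∑ w ∈ U, ∑ w' ∈ G.neighborFinset w ∩ U, x w * x w' ≤
      2 * Fintype.card W * c * ∑ w ∈ U, x w := by
  induction U using Finset.strongInduction with
  | H U ih =>
    rcases U.eq_empty_or_nonempty with rfl | hU
    · simp
    -- Otherwise the minimum degree inside `U` would suffice for a greedy copy of `T`. Deleting `w₀`
    -- costs each of its edges twice, as the sum is over ordered pairs.
    obtain ⟨w₀, hw₀, hdeg⟩ : ∃ w ∈ U, #(G.neighborFinset w ∩ U) < Fintype.card W := by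
      by_contra! hcon
      obtain ⟨φ, h1, -, h3⟩ :=
        IsTree.exists_embedding_of_le_degree G U hU _ hcon _ W T hT rfl le_rfl
      exact hfree (isContained_of_injective φ h1 h3)
    have hsum : ∑ w' ∈ G.neighborFinset w₀ ∩ U, x w' ≤ Fintype.card W * c := by
      have hc : 0 ≤ c := (h0 w₀).trans (hx w₀ hw₀)
      calc ∑ w' ∈ G.neighborFinset w₀ ∩ U, x w'
          ≤ ∑ w' ∈ G.neighborFinset w₀ ∩ U, c :=
            sum_le_sum fun w hw => hx w (mem_inter.1 hw).2
        _ = #(G.neighborFinset w₀ ∩ U) * c := by simp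
        _ ≤ _ := by gcongr
    have hIH := ih (U.erase w₀) (erase_ssubset hw₀) (fun v hv => hx v (mem_of_mem_erase hv))
    have hstep : ∀ w, ∑ w' ∈ G.neighborFinset w ∩ U, x w * x w' =
        (if G.Adj w w₀ then x w * x w₀ else 0) +
          ∑ w' ∈ G.neighborFinset w ∩ U.erase w₀, x w * x w' := by
      intro w
      by_cases hadj : G.Adj w w₀
      · rw [if_pos hadj, inter_erase, add_sum_erase _ (fun w' => x w * x w')]
        simp [hadj, hw₀]
      · rw [if_neg hadj, zero_add, inter_erase, erase_eq_of_notMem]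
        simp [hadj]
    have h1 : ∑ w ∈ U, ∑ w' ∈ G.neighborFinset w ∩ U, x w * x w' =
        2 * x w₀ * ∑ w' ∈ G.neighborFinset w₀ ∩ U, x w' +
        ∑ w ∈ U.erase w₀, ∑ w' ∈ G.neighborFinset w ∩ U.erase w₀, x w * x w' := by
      rw [← add_sum_erase _ _ hw₀, sum_congr rfl (fun w _ => hstep w), sum_add_distrib,
        ← sum_filter, ← add_assoc, ← mul_sum]
      congr 1
      have : (U.erase w₀).filter (fun w => G.Adj w w₀) = G.neighborFinset w₀ ∩ U := by
        ext w
        simp only [mem_filter, mem_erase, mem_inter, mem_neighborFinset]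
        constructor
        · rintro ⟨⟨-, h⟩, h'⟩; exact ⟨h'.symm, h⟩
        · rintro ⟨h', h⟩; exact ⟨⟨h'.ne', h⟩, h'.symm⟩
      rw [this, ← sum_mul]
      ring
    rw [h1, ← add_sum_erase _ _ hw₀, mul_add]
    refine add_le_add ?_ hIH
    nlinarith [mul_le_mul_of_nonneg_left hsum (h0 w₀)]

open scoped Classical in
theorem IsTree.sum_degree_le_of_free {W V : Type*} [Fintype W] [Fintype V] {T : SimpleGraph W}
    {G : SimpleGraph V} (hT : T.IsTree) (hfree : T.Free G) (U : Finset V) :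
    ∑ w ∈ U, (#(G.neighborFinset w ∩ U) : ℝ) ≤ 2 * Fintype.card W * #U := by
  simpa using hT.sum_mul_le_of_free hfree (c := 1) (fun _ => 1) (fun _ => zero_le_one) U
    (fun _ _ => le_rfl)

end SimpleGraph

/-! ### Copies of a tree around a complete bipartite pattern. -/

-- The common tool of the embeddings below: `S` fills `L` exactly, the other vertices go into the
-- large set `N`, and the images of the few vertices in `P` are prescribed.
open scoped Classical in
theorem Finset.exists_injective_extension {W V : Type*} [Fintype W] (S : Finset W)
    (L N : Finset V) (hLN : Disjoint L N) (hL : #S = #L) (hN : #Sᶜ ≤ #N) (P : Finset W)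
    (φ₀ : W → V) (hinj : Set.InjOn φ₀ P) (hPL : ∀ x ∈ P, x ∈ S → φ₀ x ∈ L)
    (hPN : ∀ x ∈ P, x ∉ S → φ₀ x ∈ N) :
    ∃ φ : W → V, Function.Injective φ ∧ (∀ x ∈ P, φ x = φ₀ x) ∧ (∀ x ∈ S, φ x ∈ L) ∧
      ∀ x ∉ S, φ x ∈ N := by
  have hsub : (P \ S).image φ₀ ⊆ N := by
    intro y hy
    obtain ⟨x, hx, rfl⟩ := mem_image.1 hy
    exact hPN x (mem_sdiff.1 hx).1 (mem_sdiff.1 hx).2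
  obtain ⟨N', hN1, hN2, hN3⟩ := exists_subsuperset_card_eq hsub
    (card_image_le.trans (card_le_card (fun x hx => mem_compl.2 (mem_sdiff.1 hx).2))) hN
  obtain ⟨g, hg⟩ := Set.MapsTo.exists_equiv_extend_of_card_eq (α := S) (t := L) (by simpa using hL)
    (s := {x | (x : W) ∈ P}) (f := fun x => φ₀ x) (fun x hx => hPL x hx x.2)
    (fun x hx y hy h => Subtype.ext (hinj hx hy h))
  obtain ⟨h, hh⟩ := Set.MapsTo.exists_equiv_extend_of_card_eq (α := {x // x ∉ S}) (t := N')
    (by rw [hN3, Fintype.card_subtype_compl, card_compl]; simp)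
    (s := {x | (x : W) ∈ P}) (f := fun x => φ₀ x)
    (fun x hx => hN1 (mem_image.2 ⟨x, mem_sdiff.2 ⟨hx, x.2⟩, rfl⟩))
    (fun x hx y hy h => Subtype.ext (hinj hx hy h))
  have hne : ∀ (x : S) (y : {x // x ∉ S}), (g x : V) ≠ h y := fun x y he =>
    Finset.disjoint_left.1 hLN (g x).2 (he ▸ hN2 (h y).2)
  refine ⟨fun x => if hx : x ∈ S then g ⟨x, hx⟩ else h ⟨x, hx⟩, ?_, ?_, ?_, ?_⟩
  · intro x y hxy
    by_cases hx : x ∈ S <;> by_cases hy : y ∈ S <;> simp only [hx, hy, dite_true, dite_false] at hxy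
    · simpa using g.injective (Subtype.ext hxy)
    · exact absurd hxy (hne _ _)
    · exact absurd hxy.symm (hne _ _)
    · simpa using h.injective (Subtype.ext hxy)
  · intro x hxP
    by_cases hx : x ∈ S
    · simp only [hx, dite_true]; exact hg ⟨x, hx⟩ hxP
    · simp only [hx, dite_false]; exact hh ⟨x, hx⟩ hxP
  · intro x hx
    simp only [hx, dite_true]; exact (g ⟨x, hx⟩).2
  · intro x hx
    simp only [hx, dite_false]; exact hN2 (h ⟨x, hx⟩).2

namespace SimpleGraph

/-- `A` is a colour class of a proper `2`-colouring of `T`. -/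
def IsColourClass {W : Type*} (T : SimpleGraph W) (A : Finset W) : Prop :=
  ∀ ⦃x y⦄, T.Adj x y → (x ∈ A ↔ y ∉ A)

/-- `v` is the centre of a pendant cherry: two of its three neighbours, `a` and `b`, are leaves. -/
structure IsPendantCherry {W : Type*} (T : SimpleGraph W) (v a b u : W) : Prop where
  adj_a : T.Adj v a
  adj_b : T.Adj v b
  adj_u : T.Adj v u
  a_ne_b : a ≠ b
  u_ne_a : u ≠ a
  u_ne_b : u ≠ b
  eq_of_adj_a : ∀ ⦃y⦄, T.Adj a y → y = v
  eq_of_adj_b : ∀ ⦃y⦄, T.Adj b y → y = v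
  of_adj_v : ∀ ⦃y⦄, T.Adj v y → y = a ∨ y = b ∨ y = u

section Embeddings

variable {W V : Type*} [Fintype W] {T : SimpleGraph W} {G : SimpleGraph V} {A : Finset W}

theorem IsColourClass.isContained_of_common_neighbours (hA : T.IsColourClass A) (L N : Finset V)
    (hLN : ∀ l ∈ L, ∀ y ∈ N, G.Adj l y) (hL : #L = #A) (hN : Fintype.card W ≤ #N) : T ⊑ G := by
  classical
  have hdisj : Disjoint L N := Finset.disjoint_left.2 (by
    intro x hx hy; exact (hLN x hx x hy).ne rfl)
  rcases isEmpty_or_nonempty W with hW | hW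
  · exact isContained_of_injective (fun x => hW.elim x) (fun x => hW.elim x) (fun x => hW.elim x)
  obtain ⟨y₀, -⟩ : N.Nonempty := card_pos.1 (Fintype.card_pos.trans_le hN)
  obtain ⟨φ, h1, -, h3, h4⟩ := Finset.exists_injective_extension A L N hdisj hL.symm
    ((card_le_univ _).trans hN) ∅ (fun _ => y₀) (by simp) (by simp) (by simp)
  refine isContained_of_injective φ h1 fun x y hxy => ?_
  by_cases hx : x ∈ A
  · exact hLN _ (h3 x hx) _ (h4 y ((hA hxy).1 hx))
  · have hy : y ∈ A := by by_contra hy; exact hx ((hA hxy).2 hy)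
    exact (hLN _ (h3 y hy) _ (h4 x hx)).symm

/-- The rest of `A` fills `L`, and the leaf `a`, whose only edge is `av`, is sent to `w` with `v`
sent to `y`. All other edges join `L` to `N`. -/
theorem IsColourClass.isContained_of_pendant_edge (hA : T.IsColourClass A) {a v : W} (ha : a ∈ A)
    (hav : T.Adj a v) (hleaf : ∀ y, T.Adj a y → y = v) (L N : Finset V)
    (hLN : ∀ l ∈ L, ∀ y ∈ N, G.Adj l y) (hL : #L + 1 = #A) (hN : Fintype.card W ≤ #N)
    {w y : V} (hw : w ∉ L) (hy : y ∈ N) (hwy : G.Adj w y) : T ⊑ G := by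
  classical
  have hdisj : Disjoint L N := Finset.disjoint_left.2 (by
    intro x hx hy; exact (hLN x hx x hy).ne rfl)
  have hv : v ∉ A := (hA hav).1 ha
  have hA1 : 1 ≤ #A := by omega
  -- The vertex `w` may itself lie in `N`, so it is removed there. The complement of `A` still fits
  -- because `A` is nonempty.
  obtain ⟨φ, h1, h2, h3, h4⟩ := Finset.exists_injective_extension A (insert w L) (N.erase w)
    (by
      rw [Finset.disjoint_left]
      intro x hx hx'
      rw [mem_erase] at hx'
      rw [mem_insert] at hx
      exact Finset.disjoint_left.1 hdisj (hx.resolve_left hx'.1) hx'.2)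
    (by rw [card_insert_of_notMem hw, hL])
    (by
      rw [card_compl]
      have := pred_card_le_card_erase (s := N) (a := w)
      omega)
    {a, v} (fun z => if z = a then w else y)
    (by
      intro p hp q hq hpq
      have hva : v ≠ a := hav.ne'
      simp only [coe_insert, coe_singleton, Set.mem_insert_iff, Set.mem_singleton_iff] at hp hq
      rcases hp with rfl | rfl <;> rcases hq with rfl | rfl <;> simp_all [hwy.ne, hwy.ne'])
    (by
      intro p hp hpA
      simp only [mem_insert, mem_singleton] at hp
      rcases hp with rfl | rfl
      · simp
      · exact absurd hpA hv)
    (by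
      intro p hp hpA
      simp only [mem_insert, mem_singleton] at hp
      rcases hp with rfl | rfl
      · exact absurd ha hpA
      · simp [hav.ne', hy, hwy.ne'])
  have hφa : φ a = w := by rw [h2 a (by simp)]; simp
  have hφv : φ v = y := by rw [h2 v (by simp)]; simp [hav.ne']
  have key : ∀ p q, p ∈ A → T.Adj p q → G.Adj (φ p) (φ q) := by
    intro p q hp hpq
    by_cases hpa : p = a
    · subst hpa
      rw [hleaf q hpq, hφa, hφv]; exact hwy
    · have := h3 p hp
      rw [mem_insert] at this
      exact hLN _ (this.resolve_left fun h => hpa (h1 (h.trans hφa.symm))) _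
        (mem_of_mem_erase (h4 q ((hA hpq).1 hp)))
  refine isContained_of_injective φ h1 fun p q hpq => ?_
  by_cases hp : p ∈ A
  · exact key p q hp hpq
  · exact (key q p (by by_contra hq; exact hp ((hA hpq).2 hq)) hpq.symm).symm

/-- Exchange `a` and `b` for `v`: the set `(A \ {a, b}) ∪ {v}` has `#A - 1 = #L` vertices, the only
edge inside it is `uv`, and no edge lies outside it because `a` and `b` see only `v`. One edge
inside `L` therefore suffices. -/
theorem IsColourClass.isContained_of_inner_edge (hA : T.IsColourClass A) {v a b u : W}
    (hc : T.IsPendantCherry v a b u) (hv : v ∉ A) (L N : Finset V)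
    (hLN : ∀ l ∈ L, ∀ y ∈ N, G.Adj l y) (hL : #L + 1 = #A) (hN : Fintype.card W ≤ #N)
    {w y : V} (hw : w ∈ L) (hy : y ∈ L) (hwy : G.Adj w y) : T ⊑ G := by
  classical
  have hdisj : Disjoint L N := Finset.disjoint_left.2 (by
    intro x hx hy; exact (hLN x hx x hy).ne rfl)
  have hmem : ∀ z, T.Adj v z → z ∈ A := fun z hz => by
    by_contra h; exact hv ((hA hz).2 h)
  set S : Finset W := insert v ((A.erase a).erase b) with hS
  have hSc : #S = #L := by
    rw [hS, card_insert_of_notMem (by simp [hv]), card_erase_of_mem, card_erase_of_mem]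
    · have h2 : 1 < #A := one_lt_card.2 ⟨a, hmem a hc.adj_a, b, hmem b hc.adj_b, hc.a_ne_b⟩
      omega
    · exact hmem a hc.adj_a
    · exact mem_erase.2 ⟨hc.a_ne_b.symm, hmem b hc.adj_b⟩
  have huS : u ∈ S := by simp [hS, hc.u_ne_a, hc.u_ne_b, hmem u hc.adj_u]
  have hvS : v ∈ S := by simp [hS]
  obtain ⟨φ, h1, h2, h3, h4⟩ := Finset.exists_injective_extension S L N hdisj hSc
    ((card_le_univ _).trans hN) {u, v} (fun z => if z = u then w else y)
    (by
      intro p hp q hq hpq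
      have hvu : v ≠ u := hc.adj_u.ne
      simp only [coe_insert, coe_singleton, Set.mem_insert_iff, Set.mem_singleton_iff] at hp hq
      rcases hp with rfl | rfl <;> rcases hq with rfl | rfl <;> simp_all [hwy.ne, hwy.ne'])
    (by
      intro p _ _
      split_ifs <;> assumption)
    (by
      intro p hp hpS
      simp only [mem_insert, mem_singleton] at hp
      rcases hp with rfl | rfl
      · exact absurd huS hpS
      · exact absurd hvS hpS)
  have hφu : φ u = w := by rw [h2 u (by simp)]; simp
  have hφv : φ v = y := by rw [h2 v (by simp)]; simp [hc.adj_u.ne]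
  have hin : ∀ q, q ∈ S → T.Adj v q → q = u := by
    intro q hq hvq
    simp only [hS, mem_insert, mem_erase] at hq
    rcases hc.of_adj_v hvq with h | h | h
    · rcases hq with h' | h'
      · exact absurd h'.symm hvq.ne
      · exact absurd h h'.2.1
    · rcases hq with h' | h'
      · exact absurd h'.symm hvq.ne
      · exact absurd h h'.1
    · exact h
  have hS' : ∀ q, q ∈ S → q ≠ v → q ∈ A := by
    intro q hq hqv
    simp only [hS, mem_insert, mem_erase] at hq
    exact (hq.resolve_left hqv).2.2
  have hnS : ∀ q, q ∉ S → q ∈ A → q = a ∨ q = b := by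
    intro q hq hqA
    by_contra h
    push Not at h
    exact hq (by simp [hS, h.1, h.2, hqA])
  have hout : ∀ p q, p ∉ S → q ∉ S → p ∈ A → T.Adj p q → False := by
    intro p q hp hq hpA hpq
    rcases hnS p hp hpA with rfl | rfl
    · exact hq (hc.eq_of_adj_a hpq ▸ hvS)
    · exact hq (hc.eq_of_adj_b hpq ▸ hvS)
  refine isContained_of_injective φ h1 fun p q hpq => ?_
  by_cases hp : p ∈ S <;> by_cases hq : q ∈ S
  · by_cases hpv : p = v
    · subst hpv
      rw [hin q hq hpq, hφu, hφv]; exact hwy.symm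
    · by_cases hqv : q = v
      · subst hqv
        rw [hin p hp hpq.symm, hφu, hφv]; exact hwy
      · exact absurd (hS' q hq hqv) ((hA hpq).1 (hS' p hp hpv))
  · exact hLN _ (h3 p hp) _ (h4 q hq)
  · exact (hLN _ (h3 q hq) _ (h4 p hp)).symm
  · exfalso
    by_cases hpA : p ∈ A
    · exact hout p q hp hq hpA hpq
    · exact hout q p hq hp (by by_contra h; exact hpA ((hA hpq).2 h)) hpq.symm

/-- By connectedness a copy of `T` respects the two bipartitions up to a swap, so `A` or its
complement would inject into `L`, which is smaller than both. -/
theorem IsColourClass.free_of_card_lt (hA : T.IsColourClass A) (hT : T.Connected) (L : Finset V)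
    (hL : #L < #A) (hL' : #A ≤ Fintype.card W - #A) (hG : ∀ x y, G.Adj x y → (x ∈ L ↔ y ∉ L)) :
    T.Free G := by
  classical
  rintro ⟨φ⟩
  have hstep : ∀ x y, T.Adj x y → ((φ x ∈ L ↔ x ∈ A) ↔ (φ y ∈ L ↔ y ∈ A)) := by
    intro x y hxy
    have h1 := hA hxy
    have h2 := hG _ _ (φ.toHom.map_adj hxy)
    change (φ x ∈ L ↔ φ y ∉ L) at h2
    tauto
  have hwalk : ∀ x y, T.Reachable x y → ((φ x ∈ L ↔ x ∈ A) ↔ (φ y ∈ L ↔ y ∈ A)) := by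
    rintro x y ⟨p⟩
    induction p with
    | nil => rfl
    | cons h _ ih => exact (hstep _ _ h).trans ih
  have hle : ∀ S : Finset W, (∀ x ∈ S, φ x ∈ L) → #S ≤ #L := fun S hS =>
    card_le_card_of_injOn φ hS (φ.injective.injOn)
  obtain ⟨r⟩ := hT.nonempty
  by_cases hr : (φ r ∈ L ↔ r ∈ A)
  · have := hle A fun x hx => ((hwalk r x (hT.preconnected r x)).1 hr).2 hx
    omega
  · have := hle Aᶜ fun x hx => by
      have h1 := hwalk r x (hT.preconnected r x)
      rw [mem_compl] at hx
      tauto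
    rw [card_compl] at this
    omega

end Embeddings

/-! ### Perron weights and stability. -/

section Stability

open scoped Classical

variable {W V : Type*} [Fintype W] [Fintype V] {T : SimpleGraph W} {G : SimpleGraph V}

/-- The common neighbours of a set of vertices. -/
noncomputable def commonNbrs (G : SimpleGraph V) (S : Finset V) : Finset V :=
  univ.filter fun y => ∀ l ∈ S, G.Adj l y

theorem mem_commonNbrs {S : Finset V} {y : V} : y ∈ G.commonNbrs S ↔ ∀ l ∈ S, G.Adj l y := by
  simp [commonNbrs]

theorem card_commonNbrs_ge {S : Finset V} {δ : ℝ}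
    (hS : ∀ v ∈ S, (1 - δ) * Fintype.card V ≤ #(G.neighborFinset v)) :
    (1 - #S * δ) * Fintype.card V ≤ #(G.commonNbrs S) := by
  have hsub : (G.commonNbrs S)ᶜ ⊆ S.biUnion fun v => (G.neighborFinset v)ᶜ := by
    intro y hy
    rw [mem_compl, mem_commonNbrs] at hy
    push Not at hy
    obtain ⟨l, hl, hly⟩ := hy
    exact mem_biUnion.2 ⟨l, hl, by simpa using hly⟩
  have h1 : (#(G.commonNbrs S)ᶜ : ℝ) ≤ #S * (δ * Fintype.card V) := by
    calc (#(G.commonNbrs S)ᶜ : ℝ) ≤ ∑ v ∈ S, (#(G.neighborFinset v)ᶜ : ℝ) := by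
          exact_mod_cast (card_le_card hsub).trans card_biUnion_le
      _ ≤ ∑ v ∈ S, δ * Fintype.card V := by
          refine sum_le_sum fun v hv => ?_
          have := hS v hv
          have h2 : (#(G.neighborFinset v)ᶜ : ℝ) + #(G.neighborFinset v) = Fintype.card V := by
            exact_mod_cast card_compl_add_card _
          linarith
      _ = _ := by simp
  have h2 : (#(G.commonNbrs S)ᶜ : ℝ) + #(G.commonNbrs S) = Fintype.card V := by
    exact_mod_cast card_compl_add_card _
  linarith

theorem IsTree.sum_card_inter_le_of_free (hT : T.IsTree) (hfree : T.Free G) (P Q : Finset V) :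
    ∑ y ∈ P, (#(G.neighborFinset y ∩ Q) : ℝ) ≤ 2 * Fintype.card W * (#P + #Q) := by
  calc ∑ y ∈ P, (#(G.neighborFinset y ∩ Q) : ℝ)
      ≤ ∑ y ∈ P, (#(G.neighborFinset y ∩ (P ∪ Q)) : ℝ) := by
        refine sum_le_sum fun y _ => ?_
        exact_mod_cast card_le_card (inter_subset_inter_left subset_union_right)
    _ ≤ ∑ y ∈ P ∪ Q, (#(G.neighborFinset y ∩ (P ∪ Q)) : ℝ) :=
        sum_le_sum_of_subset_of_nonneg subset_union_left fun _ _ _ => by positivity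
    _ ≤ 2 * Fintype.card W * #(P ∪ Q) := hT.sum_degree_le_of_free hfree _
    _ ≤ _ := by
        gcongr
        exact_mod_cast card_union_le P Q

theorem IsTree.sum_card_neighborFinset_le_of_free (hT : T.IsTree) (hfree : T.Free G)
    (P : Finset V) :
    ∑ y ∈ P, (#(G.neighborFinset y) : ℝ) ≤ 2 * Fintype.card W * Fintype.card V := by
  calc ∑ y ∈ P, (#(G.neighborFinset y) : ℝ)
      ≤ ∑ y ∈ (univ : Finset V), (#(G.neighborFinset y) : ℝ) :=
        sum_le_sum_of_subset_of_nonneg (subset_univ _) fun _ _ _ => by positivity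
    _ ≤ _ := by simpa using hT.sum_degree_le_of_free hfree univ

/-- A nonnegative eigenvector of the adjacency matrix, normalised to have maximum `1` at `z`. -/
structure IsPerron (G : SimpleGraph V) (r : ℝ) (x : V → ℝ) (z : V) : Prop where
  nonneg : ∀ v, 0 ≤ x v
  le_one : ∀ v, x v ≤ 1
  eq_one : x z = 1
  eig : ∀ v, ∑ u ∈ G.neighborFinset v, x u = r * x v

variable {r : ℝ} {x : V → ℝ} {z : V}

theorem IsPerron.sq_mul (h : G.IsPerron r x z) (v : V) :
    r ^ 2 * x v = ∑ y ∈ G.neighborFinset v, ∑ w ∈ G.neighborFinset y, x w := by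
  simp only [h.eig, ← mul_sum]
  ring

theorem IsPerron.mul_le_degree (h : G.IsPerron r x z) (v : V) :
    r * x v ≤ #(G.neighborFinset v) := by
  rw [← h.eig]
  calc ∑ u ∈ G.neighborFinset v, x u ≤ ∑ u ∈ G.neighborFinset v, (1 : ℝ) :=
        sum_le_sum fun u _ => h.le_one u
    _ = _ := by simp

/-- A vertex of weight `η` has degree at least `r * η`, while the degree sum is linear. With `r` of
order `√n` this leaves `O(√n)` heavy vertices, a first bound that `card_heavy_le` improves to a
constant. -/
theorem IsPerron.card_heavy_mul_le (h : G.IsPerron r x z) (hT : T.IsTree) (hfree : T.Free G)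
    (hr : 0 ≤ r) (η : ℝ) :
    #(univ.filter fun w => η ≤ x w) * (r * η) ≤ 2 * Fintype.card W * Fintype.card V := by
  calc (#(univ.filter fun w => η ≤ x w) * (r * η) : ℝ)
      = ∑ w ∈ univ.filter fun w => η ≤ x w, r * η := by simp
    _ ≤ ∑ w ∈ univ.filter fun w => η ≤ x w, (#(G.neighborFinset w) : ℝ) := by
        refine sum_le_sum fun w hw => ?_
        rw [mem_filter] at hw
        exact (mul_le_mul_of_nonneg_left hw.2 hr).trans (h.mul_le_degree w)
    _ ≤ _ := hT.sum_card_neighborFinset_le_of_free hfree _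

/-- Separating light vertices in the two-step walk count. -/
theorem IsPerron.sq_mul_le (h : G.IsPerron r x z) (hT : T.IsTree) (hfree : T.Free G)
    {η : ℝ} (hη : 0 ≤ η) (v : V) :
    r ^ 2 * x v ≤
      ∑ y ∈ G.neighborFinset v, ∑ w ∈ G.neighborFinset y ∩ univ.filter (fun w => η ≤ x w), x w +
        2 * Fintype.card W * Fintype.card V * η := by
  rw [h.sq_mul]
  calc ∑ y ∈ G.neighborFinset v, ∑ w ∈ G.neighborFinset y, x w
      ≤ ∑ y ∈ G.neighborFinset v,
        (∑ w ∈ G.neighborFinset y ∩ univ.filter (fun w => η ≤ x w), x w +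
          #(G.neighborFinset y) * η) := by
        refine sum_le_sum fun y _ => ?_
        rw [← sum_inter_add_sum_sdiff (G.neighborFinset y) (univ.filter (fun w => η ≤ x w))]
        refine add_le_add le_rfl ?_
        calc ∑ w ∈ G.neighborFinset y \ univ.filter (fun w => η ≤ x w), x w
            ≤ ∑ w ∈ G.neighborFinset y \ univ.filter (fun w => η ≤ x w), η := by
              refine sum_le_sum fun w hw => ?_
              simp only [mem_sdiff, mem_filter, mem_univ, true_and, not_le] at hw
              exact hw.2.le
          _ = #(G.neighborFinset y \ univ.filter (fun w => η ≤ x w)) * η := by simp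
          _ ≤ _ := by
              gcongr
              exact sdiff_subset
    _ ≤ _ := by
        rw [sum_add_distrib, ← sum_mul]
        gcongr
        exact hT.sum_card_neighborFinset_le_of_free hfree _

/-- Heavy vertices have linear degree. -/
theorem IsPerron.degree_of_heavy (h : G.IsPerron r x z) (hT : T.IsTree) (hfree : T.Free G)
    {η : ℝ} (hη : 0 < η) (hr0 : 0 < r) (hr : (Fintype.card V : ℝ) / 2 ≤ r ^ 2)
    (hlarge : 2 * Fintype.card W ≤ r * (η / (16 * Fintype.card W)) ^ 2) {v : V} (hv : η ≤ x v) :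
    η * Fintype.card V ≤ 8 * Fintype.card W * #(G.neighborFinset v) := by
  have hW : (0 : ℝ) < Fintype.card W := by
    have := hT.1.nonempty
    exact_mod_cast Fintype.card_pos
  set m : ℝ := (Fintype.card W : ℝ) with hm
  set n : ℝ := (Fintype.card V : ℝ) with hn_def
  have hn : 0 ≤ n := by positivity
  -- With this threshold, the vertices in `L'` and those below it contribute at most `4 * m * η' * n
  -- = η * n / 4` to the walk count, half of the lower bound `η * n / 2`.
  set η' : ℝ := η / (16 * m) with hη'
  have hη'0 : 0 < η' := by positivity
  have hηη' : 16 * m * η' = η := by rw [hη']; field_simp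
  set L' := univ.filter (fun w => η' ≤ x w)
  have h1 : #L' * (r * η') ≤ 2 * m * n := h.card_heavy_mul_le hT hfree hr0.le η'
  have h2 : (#L' : ℝ) ≤ η' * n := by
    have : #L' * (r * η') ≤ (η' * n) * (r * η') := by
      nlinarith [mul_le_mul_of_nonneg_right hlarge hn]
    exact le_of_mul_le_mul_right this (by positivity)
  have h3 := h.sq_mul_le hT hfree hη'0.le v
  have h4 : ∑ y ∈ G.neighborFinset v, ∑ w ∈ G.neighborFinset y ∩ L', x w ≤
      2 * m * (#(G.neighborFinset v) + #L') := by
    refine le_trans (sum_le_sum fun y _ => ?_) (hT.sum_card_inter_le_of_free hfree _ L')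
    calc ∑ w ∈ G.neighborFinset y ∩ L', x w ≤ ∑ w ∈ G.neighborFinset y ∩ L', (1 : ℝ) :=
          sum_le_sum fun u _ => h.le_one u
      _ = _ := by simp
  have h5 : n / 2 * η ≤ r ^ 2 * x v := mul_le_mul hr hv hη.le (by positivity)
  have h6 : 2 * m * #L' ≤ 2 * m * (η' * n) := by gcongr
  have h7 : m * η' * n = η * n / 16 := by rw [← hηη']; ring
  nlinarith

/-- Heavy vertices have linear degree and the degree sum is linear, so their number is bounded
independently of `n`. -/
theorem IsPerron.card_heavy_le (h : G.IsPerron r x z) (hT : T.IsTree) (hfree : T.Free G)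
    {η : ℝ} (hη : 0 < η) (hr0 : 0 < r) (hr : (Fintype.card V : ℝ) / 2 ≤ r ^ 2)
    (hlarge : 2 * Fintype.card W ≤ r * (η / (16 * Fintype.card W)) ^ 2) :
    (#(univ.filter fun w => η ≤ x w) : ℝ) ≤ 16 * (Fintype.card W) ^ 2 / η := by
  have hn : (0 : ℝ) < Fintype.card V := by
    have : Nonempty V := ⟨z⟩
    exact_mod_cast Fintype.card_pos
  have h1 : (#(univ.filter fun w => η ≤ x w) : ℝ) * (η * Fintype.card V) ≤
      8 * Fintype.card W * (2 * Fintype.card W * Fintype.card V) := by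
    calc (#(univ.filter fun w => η ≤ x w) : ℝ) * (η * Fintype.card V)
        = ∑ w ∈ univ.filter fun w => η ≤ x w, η * Fintype.card V := by simp
      _ ≤ ∑ w ∈ univ.filter fun w => η ≤ x w, 8 * Fintype.card W * (#(G.neighborFinset w) : ℝ) := by
          refine sum_le_sum fun w hw => ?_
          rw [mem_filter] at hw
          exact h.degree_of_heavy hT hfree hη hr0 hr hlarge hw.2
      _ ≤ _ := by
          rw [← mul_sum]
          gcongr
          exact hT.sum_card_neighborFinset_le_of_free hfree _
  rw [le_div_iff₀ hη]
  refine le_of_mul_le_mul_right ?_ hn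
  linarith

/-- Each exceptional vertex is a common neighbour of some `#A`-subset of `H`, and no such subset has
`Fintype.card W` common neighbours, or `T` would embed. -/
theorem IsColourClass.card_exceptional_le {A : Finset W} (hA : T.IsColourClass A)
    (hfree : T.Free G) (H : Finset V) :
    #(univ.filter fun y => #A ≤ #(G.neighborFinset y ∩ H)) ≤ 2 ^ #H * Fintype.card W := by
  have hsub : (univ.filter fun y => #A ≤ #(G.neighborFinset y ∩ H)) ⊆
      (powersetCard #A H).biUnion fun S => G.commonNbrs S := by
    intro y hy
    rw [mem_filter] at hy
    obtain ⟨S, hS, hSc⟩ := exists_subset_card_eq hy.2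
    rw [subset_inter_iff] at hS
    refine mem_biUnion.2 ⟨S, mem_powersetCard.2 ⟨hS.2, hSc⟩, mem_commonNbrs.2 fun l hl => ?_⟩
    simpa [adj_comm] using hS.1 hl
  calc _ ≤ _ := card_le_card hsub
    _ ≤ ∑ S ∈ powersetCard #A H, #(G.commonNbrs S) := card_biUnion_le
    _ ≤ ∑ S ∈ powersetCard #A H, Fintype.card W := by
        refine sum_le_sum fun S hS => ?_
        by_contra! hlt
        exact hfree (hA.isContained_of_common_neighbours S _
          (fun l hl y hy => mem_commonNbrs.1 hy l hl) (mem_powersetCard.1 hS).2 hlt.le)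
    _ ≤ _ := by
        rw [sum_const, smul_eq_mul]
        gcongr
        rw [card_powersetCard]
        exact Nat.choose_le_two_pow _ _

omit [Fintype V] in
theorem sum_le_of_exceptional {P B : Finset V} {g : V → ℝ} {κ h b : ℝ} (hκ : 0 ≤ κ) (hh : 0 ≤ h)
    (hB : (#B : ℝ) ≤ b) (hg : ∀ y, g y ≤ h) (hgB : ∀ y ∉ B, g y ≤ κ) :
    ∑ y ∈ P, g y ≤ κ * #P + h * b := by
  calc ∑ y ∈ P, g y ≤ ∑ y ∈ P, (κ + if y ∈ B then h else 0) := by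
        refine sum_le_sum fun y _ => ?_
        split_ifs with hy
        · linarith [hg y]
        · linarith [hgB y hy]
    _ = κ * #P + h * #(P ∩ B) := by
        rw [sum_add_distrib, ← sum_filter, filter_mem_eq_inter]
        simp [mul_comm]
    _ ≤ _ := by
        gcongr
        exact le_trans (by exact_mod_cast card_le_card inter_subset_right) hB

end Stability

section Stability

open scoped Classical

variable {W V : Type*} [Fintype W] [Fintype V] {T : SimpleGraph W} {G : SimpleGraph V}
variable {r : ℝ} {x : V → ℝ} {z : V}

set_option maxHeartbeats 1000000 in
/-- Stability: a graph without the tree `T` and with large spectral radius has `k` vertices of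
nearly full degree. -/
theorem IsPerron.exists_dominating_set (h : G.IsPerron r x z) (hT : T.IsTree) (hfree : T.Free G)
    {A : Finset W} (hA : T.IsColourClass A) {k : ℕ} (hAk : #A = k + 1) (hk : 1 ≤ k)
    {θ : ℝ} (hθ : 0 < θ) (hθk : θ * (4 * (k + 1)) ≤ 1) (hr0 : 0 < r)
    (hr : (k : ℝ) * (Fintype.card V - k) ≤ r ^ 2) (hn1 : 2 * k ≤ Fintype.card V)
    (hlarge : 2 * Fintype.card W ≤ r * (θ / (4 * Fintype.card W) / (16 * Fintype.card W)) ^ 2)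
    {b : ℕ} (hb : 16 * (Fintype.card W : ℝ) ^ 2 / (θ / (4 * Fintype.card W)) ≤ b)
    (hn2 : (k : ℝ) ^ 2 + b * (2 ^ b * Fintype.card W) < Fintype.card V * (θ / 2))
    (hn3 : 2 * Fintype.card W ≤ Fintype.card V) :
    ∃ L : Finset V, #L = k ∧ (∀ u ∈ L, 1 - θ ≤ x u) ∧
      (1 - k * (2 * θ)) * Fintype.card V ≤ #(G.commonNbrs L) := by
  have hW : (0 : ℝ) < Fintype.card W := by
    have := hT.1.nonempty
    exact_mod_cast Fintype.card_pos
  set m : ℝ := (Fintype.card W : ℝ) with hm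
  set n : ℝ := (Fintype.card V : ℝ) with hn_def
  have hn1' : 2 * (k : ℝ) ≤ n := by rw [hn_def]; exact_mod_cast hn1
  have hn3' : 2 * m ≤ n := by rw [hn_def, hm]; exact_mod_cast hn3
  have hk' : (1 : ℝ) ≤ k := by exact_mod_cast hk
  have hn : 0 < n := by linarith
  -- Makes the total contribution of light vertices, `2 * m * n * η`, equal to `n * (θ / 2)`.
  set η : ℝ := θ / (4 * m) with hη_def
  have hη : 0 < η := by positivity
  have hηm : 4 * m * η = θ := by rw [hη_def]; field_simp
  have hθ1 : θ ≤ 1 := by nlinarith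
  have hr2 : n / 2 ≤ r ^ 2 := by nlinarith
  set H := univ.filter (fun w => η ≤ x w) with hH_def
  have hHb : #H ≤ b := by
    exact_mod_cast (h.card_heavy_le hT hfree hη hr0 hr2 hlarge).trans hb
  set B := univ.filter (fun y => #A ≤ #(G.neighborFinset y ∩ H)) with hB_def
  have hB : (#B : ℝ) ≤ 2 ^ b * m := by
    have h1 := (hA.card_exceptional_le hfree H).trans
      (Nat.mul_le_mul_right _ (Nat.pow_le_pow_right two_pos hHb))
    rw [hm]; exact_mod_cast h1
  have hcount : ∀ y, ∀ S ⊆ H, ∑ w ∈ G.neighborFinset y ∩ S, x w ≤ #(G.neighborFinset y ∩ S) := by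
    intro y S _
    calc ∑ w ∈ G.neighborFinset y ∩ S, x w ≤ ∑ w ∈ G.neighborFinset y ∩ S, (1 : ℝ) :=
          sum_le_sum fun u _ => h.le_one u
      _ = _ := by simp
  have hgb : ∀ y, ∑ w ∈ G.neighborFinset y ∩ H, x w ≤ b := by
    intro y
    refine (hcount y H subset_rfl).trans ?_
    exact_mod_cast (card_le_card inter_subset_right).trans hHb
  have hnotB : ∀ y ∉ B, #(G.neighborFinset y ∩ H) ≤ k := by
    intro y hy
    simp only [hB_def, mem_filter, mem_univ, true_and, not_le] at hy
    omega
  have hlight : 2 * m * n * η = n * (θ / 2) := by rw [← hηm]; ring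
  have hsq := fun v => h.sq_mul_le hT hfree hη.le v
  -- heavy vertices have almost full degree
  set L := univ.filter (fun w => 1 - θ ≤ x w) with hL_def
  have hdeg : ∀ v ∈ L, (1 - 2 * θ) * n ≤ #(G.neighborFinset v) := by
    intro v hv
    rw [hL_def, mem_filter] at hv
    have h1 := hsq v
    have h2 := sum_le_of_exceptional (P := G.neighborFinset v) (B := B)
      (g := fun y => ∑ w ∈ G.neighborFinset y ∩ H, x w) (κ := k) (by positivity)
      (Nat.cast_nonneg b) hB hgb (fun y hy => (hcount y H subset_rfl).trans
        (by exact_mod_cast hnotB y hy))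
    have h3 : (k : ℝ) * (n - k) * (1 - θ) ≤ r ^ 2 * x v :=
      mul_le_mul hr hv.2 (by linarith) (by positivity)
    have h4 : (k : ℝ) * (n - k) * (1 - θ) ≤
        k * #(G.neighborFinset v) + b * (2 ^ b * m) + n * (θ / 2) := by linarith
    have hC : (0 : ℝ) ≤ b * (2 ^ b * m) := by positivity
    have h5 : (k : ℝ) * ((1 - 2 * θ) * n) ≤ k * #(G.neighborFinset v) := by
      nlinarith [mul_nonneg (sub_nonneg.2 hk') (mul_nonneg hn.le hθ.le)]
    exact le_of_mul_le_mul_left h5 (by linarith)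
  have hcommon : ∀ S ⊆ L, (1 - #S * (2 * θ)) * n ≤ #(G.commonNbrs S) := fun S hS =>
    card_commonNbrs_ge fun v hv => hdeg v (hS hv)
  -- Any `k + 1` members of `L` would have at least `(1 - 2 * (k + 1) * θ) * n ≥ n / 2 ≥ m` common
  -- neighbours, enough to embed `T`.
  have hLle : #L ≤ k := by
    by_contra! hlt
    obtain ⟨S, hSL, hSc⟩ := exists_subset_card_eq (Nat.succ_le_of_lt hlt)
    have h1 := hcommon S hSL
    rw [hSc] at h1
    push_cast at h1
    have h2 : m ≤ #(G.commonNbrs S) := by nlinarith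
    exact hfree (hA.isContained_of_common_neighbours S _
      (fun l hl y hy => mem_commonNbrs.1 hy l hl) (by rw [hSc, hAk]) (by
        rw [hm] at h2; exact_mod_cast h2))
  have hLH : L ⊆ H := by
    intro w hw
    rw [hL_def, mem_filter] at hw
    rw [hH_def, mem_filter]
    refine ⟨mem_univ _, le_trans ?_ hw.2⟩
    have hm2 : 2 ≤ m := by
      have : 2 ≤ Fintype.card W := by have := card_le_univ A; omega
      rw [hm]; exact_mod_cast this
    nlinarith
  -- With fewer than `k` members, each unexceptional vertex sees heavy weight at most `k - θ`: among
  -- its at most `k` heavy neighbours, at most `k - 1` exceed `1 - θ`. The walk count at `z`, where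
  -- the weight is 1, is then too small.
  have hLge : k ≤ #L := by
    by_contra! hlt
    have hg : ∀ y ∉ B, ∑ w ∈ G.neighborFinset y ∩ H, x w ≤ k - θ := by
      intro y hy
      rw [← sum_inter_add_sum_sdiff (G.neighborFinset y ∩ H) L]
      have hp : #(G.neighborFinset y ∩ H ∩ L) + 1 ≤ k := by
        have := card_le_card (inter_subset_right : G.neighborFinset y ∩ H ∩ L ⊆ L)
        omega
      have hq := hnotB y hy
      rw [← card_inter_add_card_sdiff (G.neighborFinset y ∩ H) L] at hq
      have h1 : ∑ w ∈ G.neighborFinset y ∩ H ∩ L, x w ≤ #(G.neighborFinset y ∩ H ∩ L) := by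
        rw [inter_assoc]
        exact hcount y _ inter_subset_left
      have h2 : ∑ w ∈ (G.neighborFinset y ∩ H) \ L, x w ≤
          #((G.neighborFinset y ∩ H) \ L) * (1 - θ) := by
        calc ∑ w ∈ (G.neighborFinset y ∩ H) \ L, x w
            ≤ ∑ w ∈ (G.neighborFinset y ∩ H) \ L, (1 - θ) := by
              refine sum_le_sum fun w hw => ?_
              rw [mem_sdiff, hL_def, mem_filter] at hw
              have := hw.2
              simp only [mem_univ, true_and, not_le] at this
              exact this.le
          _ = _ := by rw [sum_const, nsmul_eq_mul]
      have hp' : (#(G.neighborFinset y ∩ H ∩ L) : ℝ) + 1 ≤ k := by exact_mod_cast hp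
      have hq' : (#(G.neighborFinset y ∩ H ∩ L) : ℝ) + #((G.neighborFinset y ∩ H) \ L) ≤ k := by
        exact_mod_cast hq
      nlinarith
    have h1 := hsq z
    rw [h.eq_one, mul_one] at h1
    have h2 := sum_le_of_exceptional (P := G.neighborFinset z) (B := B)
      (g := fun y => ∑ w ∈ G.neighborFinset y ∩ H, x w) (κ := k - θ) (by linarith)
      (Nat.cast_nonneg b) hB hgb hg
    have h3 : (k - θ) * (#(G.neighborFinset z) : ℝ) ≤ (k - θ) * n := by
      have : (#(G.neighborFinset z) : ℝ) ≤ n := by rw [hn_def]; exact_mod_cast card_le_univ _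
      exact mul_le_mul_of_nonneg_left this (by linarith)
    have h4 : (k : ℝ) * (n - k) ≤ (k - θ) * n + b * (2 ^ b * m) + n * (θ / 2) := by linarith
    linarith
  have hLk : #L = k := le_antisymm hLle hLge
  refine ⟨L, hLk, fun u hu => ?_, ?_⟩
  · rw [hL_def, mem_filter] at hu; exact hu.2
  · have := hcommon L subset_rfl
    rwa [hLk] at this

/-- The graph `G` is the complete bipartite graph with parts `L` and `Lᶜ`. -/
def IsBicliqueOn (G : SimpleGraph V) (L : Finset V) : Prop :=
  ∀ a b, G.Adj a b ↔ (a ∈ L ↔ b ∉ L)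

/-- The left side is the quadratic form of `K_{k,n-k}`. Cauchy–Schwarz on each part, then the
arithmetic–geometric mean inequality, bounds it. -/
theorem two_mul_sum_mul_sum_compl_le [DecidableEq V] {k : ℕ} {L : Finset V} (hL : #L = k) (x : V → ℝ) {r : ℝ}
    (hr0 : 0 ≤ r) (hr : (k : ℝ) * (Fintype.card V - k) ≤ r ^ 2) :
    2 * ((∑ u ∈ L, x u) * ∑ v ∈ Lᶜ, x v) ≤ r * ∑ v, x v ^ 2 := by
  have h1 : (∑ u ∈ L, x u) ^ 2 ≤ k * ∑ u ∈ L, x u ^ 2 := by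
    have := sq_sum_le_card_mul_sum_sq (s := L) (f := x)
    rwa [hL] at this
  have hc : (#Lᶜ : ℝ) = Fintype.card V - k := by
    rw [eq_sub_iff_add_eq, ← hL]; exact_mod_cast card_compl_add_card L
  have h2 : (∑ u ∈ Lᶜ, x u) ^ 2 ≤ (Fintype.card V - k) * ∑ u ∈ Lᶜ, x u ^ 2 := by
    have := sq_sum_le_card_mul_sum_sq (s := Lᶜ) (f := x)
    rwa [hc] at this
  rw [← sum_add_sum_compl L fun v => x v ^ 2]
  set a := ∑ u ∈ L, x u ^ 2
  set b := ∑ u ∈ Lᶜ, x u ^ 2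
  set s := ∑ u ∈ L, x u
  set t := ∑ u ∈ Lᶜ, x u
  have ha : 0 ≤ a := sum_nonneg fun _ _ => sq_nonneg _
  have hb : 0 ≤ b := sum_nonneg fun _ _ => sq_nonneg _
  refine (abs_le_of_sq_le_sq' ?_ (by positivity)).2
  have h3 : (s * t) ^ 2 ≤ r ^ 2 * (a * b) := by
    calc (s * t) ^ 2 = s ^ 2 * t ^ 2 := by ring
      _ ≤ (k * a) * ((Fintype.card V - k) * b) :=
          mul_le_mul h1 h2 (sq_nonneg _) (by positivity)
      _ = (k * (Fintype.card V - k)) * (a * b) := by ring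
      _ ≤ _ := by gcongr
  nlinarith [mul_nonneg (sq_nonneg r) (sq_nonneg (a - b))]

end Stability

/-! ### From stability to the exact bipartite structure. -/

section Structure

open scoped Classical

variable {W V : Type*} [Fintype W] [Fintype V] {T : SimpleGraph W} {G : SimpleGraph V}
variable {r : ℝ} {x : V → ℝ} {z : V}

theorem sum_sum_neighborFinset_comm (G : SimpleGraph V) (P Q : Finset V) (f : V → V → ℝ) :
    ∑ v ∈ P, ∑ w ∈ G.neighborFinset v ∩ Q, f v w = ∑ w ∈ Q, ∑ v ∈ G.neighborFinset w ∩ P, f v w := by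
  refine sum_comm' fun v w => ?_
  simp only [mem_inter, mem_neighborFinset, adj_comm]
  tauto

/-- The part `L` dominates `N`, `N` only sees `L`, and the few remaining vertices have small
weight: then there are no remaining vertices. -/
theorem IsPerron.isBicliqueOn (h : G.IsPerron r x z) (hT : T.IsTree) (hfree : T.Free G)
    {k : ℕ} (hk : 1 ≤ k) {L : Finset V} (hLk : #L = k) (hL : ∀ u ∈ L, 1 / 2 ≤ x u)
    (hLL : ∀ u ∈ L, ∀ w ∈ L, ¬ G.Adj u w)
    (hN : ∀ y ∈ G.commonNbrs L, ∀ w, G.Adj y w → w ∈ L)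
    (hr0 : 0 < r) (hr : (k : ℝ) * (Fintype.card V - k) ≤ r ^ 2) (hn1 : 2 * k ≤ Fintype.card V)
    {δ : ℝ} (hδN : (1 - δ) * Fintype.card V ≤ #(G.commonNbrs L))
    (hδ : 2 * (k + 2 * Fintype.card W) * δ * (8 * Fintype.card W) ≤ 1)
    (hlarge : 8 * Fintype.card W * k ≤ r) : G.IsBicliqueOn L := by
  have hW : (0 : ℝ) < Fintype.card W := by
    have := hT.1.nonempty
    exact_mod_cast Fintype.card_pos
  have hn1' : 2 * (k : ℝ) ≤ Fintype.card V := by exact_mod_cast hn1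
  have hk' : (1 : ℝ) ≤ k := by exact_mod_cast hk
  have hr2 : (Fintype.card V : ℝ) / 2 ≤ r ^ 2 := by nlinarith
  set N := G.commonNbrs L with hN_def
  have hLN : Disjoint L N := Finset.disjoint_left.2 (by
    intro u hu hu'
    exact (mem_commonNbrs.1 hu' u hu).ne rfl)
  set E := (L ∪ N)ᶜ with hE_def
  have hcard : #L + #N + #E = Fintype.card V := by
    rw [← card_union_of_disjoint hLN, hE_def]; exact card_add_card_compl _
  have hcard' : (k : ℝ) + #N + #E = Fintype.card V := by rw [← hLk]; exact_mod_cast hcard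
  have hEδ : (#E : ℝ) ≤ δ * Fintype.card V := by linarith
  have hsplit : ∀ f : V → ℝ, ∑ v, f v = ∑ v ∈ L, f v + ∑ v ∈ N, f v + ∑ v ∈ E, f v := by
    intro f
    rw [← sum_union hLN, hE_def, sum_add_sum_compl]
  have hmemE : ∀ w, w ∈ E ↔ w ∉ L ∧ w ∉ N := by intro w; simp [hE_def]
  have hLE : Disjoint L E := Finset.disjoint_left.2 (by
    intro u hu hu'; exact ((hmemE u).1 hu').1 hu)
  -- neighbourhoods
  have hnbL : ∀ u ∈ L, ∑ w ∈ G.neighborFinset u, x w =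
      ∑ w ∈ N, x w + ∑ w ∈ G.neighborFinset u ∩ E, x w := by
    intro u hu
    rw [← sum_union]
    · congr 1
      ext w
      simp only [mem_union, mem_inter, mem_neighborFinset, hmemE]
      constructor
      · intro huw
        by_cases hw : w ∈ N
        · exact Or.inl hw
        · exact Or.inr ⟨huw, fun hwL => hLL u hu w hwL huw, hw⟩
      · rintro (hw | hw)
        · exact mem_commonNbrs.1 hw u hu
        · exact hw.1
    · refine Finset.disjoint_left.2 (by
        intro w hw hw'; exact ((hmemE w).1 (mem_inter.1 hw').2).2 hw)
  have hnbN : ∀ y ∈ N, ∑ w ∈ G.neighborFinset y, x w = ∑ w ∈ L, x w := by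
    intro y hy
    congr 1
    ext w
    rw [mem_neighborFinset]
    exact ⟨hN y hy w, fun hw => (mem_commonNbrs.1 hy w hw).symm⟩
  have hnbE : ∀ w ∈ E, ∑ v ∈ G.neighborFinset w, x v =
      ∑ v ∈ G.neighborFinset w ∩ L, x v + ∑ v ∈ G.neighborFinset w ∩ E, x v := by
    intro w hw
    rw [← sum_union (Disjoint.mono inter_subset_right inter_subset_right hLE),
      ← inter_union_distrib_left]
    congr 1
    ext v
    simp only [mem_inter, mem_union, mem_neighborFinset, hmemE]
    refine ⟨fun hwv => ⟨hwv, ?_⟩, fun h => h.1⟩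
    by_cases hv : v ∈ L
    · exact Or.inl hv
    · exact Or.inr ⟨hv, fun hvN => ((hmemE w).1 hw).1 (hN v hvN w hwv.symm)⟩
  -- the vertices of `E` have small weight
  have hxE : ∀ w ∈ E, x w ≤ 1 / (4 * Fintype.card W) := by
    have hstep : ∀ w ∈ E, r * x w ≤ k + ∑ v ∈ G.neighborFinset w ∩ E, x v := by
      intro w hw
      rw [← h.eig, hnbE w hw]
      refine add_le_add ?_ le_rfl
      calc ∑ v ∈ G.neighborFinset w ∩ L, x v ≤ ∑ v ∈ G.neighborFinset w ∩ L, (1 : ℝ) :=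
            sum_le_sum fun v _ => h.le_one v
        _ = #(G.neighborFinset w ∩ L) := by simp
        _ ≤ k := by rw [← hLk]; exact_mod_cast card_le_card inter_subset_right
    intro w hw
    -- The eigenvalue equation is applied twice; degeneracy bounds the degree sum inside `E`.
    have h1 : r * (r * x w) ≤ r * k + (k * #E + 2 * Fintype.card W * #E) := by
      calc r * (r * x w) ≤ r * (k + ∑ v ∈ G.neighborFinset w ∩ E, x v) :=
            mul_le_mul_of_nonneg_left (hstep w hw) hr0.le
        _ = r * k + ∑ v ∈ G.neighborFinset w ∩ E, r * x v := by rw [mul_add, mul_sum]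
        _ ≤ r * k + ∑ v ∈ E, (k + (#(G.neighborFinset v ∩ E) : ℝ)) := by
            refine add_le_add le_rfl ?_
            calc ∑ v ∈ G.neighborFinset w ∩ E, r * x v
                ≤ ∑ v ∈ G.neighborFinset w ∩ E, (k + (#(G.neighborFinset v ∩ E) : ℝ)) := by
                  refine sum_le_sum fun v hv => (hstep v (mem_inter.1 hv).2).trans ?_
                  refine add_le_add le_rfl ?_
                  calc ∑ u ∈ G.neighborFinset v ∩ E, x u
                      ≤ ∑ u ∈ G.neighborFinset v ∩ E, (1 : ℝ) :=
                        sum_le_sum fun u _ => h.le_one u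
                    _ = _ := by simp
              _ ≤ _ := sum_le_sum_of_subset_of_nonneg inter_subset_right
                  fun _ _ _ => by positivity
        _ ≤ _ := by
            rw [sum_add_distrib, sum_const, nsmul_eq_mul, mul_comm (#E : ℝ) (k : ℝ)]
            refine add_le_add le_rfl (add_le_add le_rfl ?_)
            exact hT.sum_degree_le_of_free hfree E
    set m : ℝ := (Fintype.card W : ℝ) with hm
    set n : ℝ := (Fintype.card V : ℝ) with hn
    have h2 : (k + 2 * m) * #E ≤ (k + 2 * m) * (δ * n) :=
      mul_le_mul_of_nonneg_left hEδ (by positivity)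
    have h3 : 8 * m * ((k + 2 * m) * (δ * n)) ≤ r ^ 2 := by
      have hn0 : 0 ≤ n := by positivity
      nlinarith [mul_le_mul_of_nonneg_right hδ hn0]
    have h4 : 8 * m * (r * k) ≤ r ^ 2 := by nlinarith
    have h5 : r ^ 2 * (x w * (4 * m)) ≤ r ^ 2 * 1 := by nlinarith
    rw [le_div_iff₀ (by positivity)]
    exact le_of_mul_le_mul_left h5 (by positivity)
  -- comparison of quadratic forms
  set s := ∑ u ∈ L, x u with hs
  set t := ∑ u ∈ N, x u with ht
  set e := ∑ u ∈ E, x u with he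
  set p := ∑ w ∈ E, x w * ∑ v ∈ G.neighborFinset w ∩ L, x v with hp
  set q := ∑ w ∈ E, x w * ∑ v ∈ G.neighborFinset w ∩ E, x v with hq
  have he0 : 0 ≤ e := sum_nonneg fun v _ => h.nonneg v
  have hquad : r * ∑ v, x v ^ 2 = 2 * (s * t) + 2 * p + q := by
    have h1 : r * ∑ v, x v ^ 2 = ∑ v, x v * ∑ u ∈ G.neighborFinset v, x u := by
      rw [mul_sum]
      refine sum_congr rfl fun v _ => ?_
      rw [h.eig]; ring
    have hp' : p = ∑ v ∈ L, x v * ∑ w ∈ G.neighborFinset v ∩ E, x w := by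
      simp only [hp, mul_sum]
      rw [sum_sum_neighborFinset_comm]
      exact sum_congr rfl fun _ _ => sum_congr rfl fun _ _ => mul_comm _ _
    rw [h1, hsplit]
    have hL1 : ∑ v ∈ L, x v * ∑ u ∈ G.neighborFinset v, x u = s * t + p := by
      rw [hp', hs, sum_mul, ← sum_add_distrib]
      exact sum_congr rfl fun v hv => by rw [hnbL v hv]; ring
    have hN1 : ∑ v ∈ N, x v * ∑ u ∈ G.neighborFinset v, x u = t * s := by
      rw [ht, sum_mul]
      exact sum_congr rfl fun v hv => by rw [hnbN v hv]
    have hE1 : ∑ v ∈ E, x v * ∑ u ∈ G.neighborFinset v, x u = p + q := by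
      rw [hp, hq, ← sum_add_distrib]
      exact sum_congr rfl fun v hv => by rw [hnbE v hv]; ring
    rw [hL1, hN1, hE1]; ring
  -- A vertex of `E` is not in `N`, so it misses a member of `L`, whose weight is at least `1 / 2`.
  have hp_le : p ≤ e * (s - 1 / 2) := by
    rw [he, sum_mul]
    refine sum_le_sum fun w hw => mul_le_mul_of_nonneg_left ?_ (h.nonneg w)
    have hwN := ((hmemE w).1 hw).2
    rw [hN_def, mem_commonNbrs] at hwN
    push Not at hwN
    obtain ⟨l, hl, hlw⟩ := hwN
    have h1 : ∑ v ∈ G.neighborFinset w ∩ L, x v ≤ ∑ v ∈ L.erase l, x v := by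
      refine sum_le_sum_of_subset_of_nonneg ?_ fun v _ _ => h.nonneg v
      intro v hv
      rw [mem_inter, mem_neighborFinset] at hv
      refine mem_erase.2 ⟨?_, hv.2⟩
      rintro rfl
      exact hlw hv.1.symm
    have h2 := sum_erase_add L x hl
    have h3 := hL l hl
    linarith
  -- Degeneracy with weights at most `c = 1 / (4m)` on `E`: the bound `2 * m * c * e` is `e / 2`.
  have hq_le : q ≤ e / 2 := by
    have h1 := hT.sum_mul_le_of_free hfree x h.nonneg E hxE
    simp only [← mul_sum] at h1
    refine h1.trans (le_of_eq ?_)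
    rw [← he]; field_simp; norm_num
  have hcs := two_mul_sum_mul_sum_compl_le hLk x hr0.le hr
  have hLc : ∑ v ∈ Lᶜ, x v = t + e := by
    have h1 := hsplit x
    rw [← sum_add_sum_compl L] at h1
    linarith
  rw [hLc, ← hs, hquad] at hcs
  -- Here `2s(t + e) ≤ 2st + 2p + q ≤ 2s(t + e) - e / 2`.
  have he_zero : e = 0 := by nlinarith
  have hxE0 : ∀ w ∈ E, x w = 0 := by
    intro w hw
    exact (sum_eq_zero_iff_of_nonneg fun v _ => h.nonneg v).1 he_zero w hw
  -- hence `E` is empty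
  have hst : r * s = k * t := by
    rw [hs, mul_sum, ← hLk, ← nsmul_eq_mul, ← sum_const]
    refine sum_congr rfl fun u hu => ?_
    rw [← h.eig, hnbL u hu, sum_eq_zero (fun w hw => hxE0 w (mem_inter.1 hw).2), add_zero]
  have hts : r * t = #N * s := by
    rw [ht, mul_sum, ← nsmul_eq_mul, ← sum_const]
    exact sum_congr rfl fun u hu => by rw [← h.eig, hnbN u hu]
  have hs0 : 0 < s := by
    refine sum_pos (fun u hu => by linarith [hL u hu]) (card_pos.1 (by omega))
  -- The weights now solve the eigenvalue equations of `K_{k,#N}`. As `r ^ 2 ≥ k * (n - k)` and `n -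
  -- k = #N + #E`, nothing is left for `E`.
  have hr3 : r ^ 2 = k * #N := by
    have : r ^ 2 * s = (k * #N) * s := by
      calc r ^ 2 * s = r * (r * s) := by ring
        _ = k * (r * t) := by rw [hst]; ring
        _ = _ := by rw [hts]; ring
    exact mul_right_cancel₀ hs0.ne' this
  have hE0 : #E = 0 := by
    have h1 : (k : ℝ) * #E ≤ 0 := by
      rw [hr3, ← hcard'] at hr
      linarith
    have h2 : (#E : ℝ) ≤ 0 := by nlinarith [(Nat.cast_nonneg #E : (0 : ℝ) ≤ #E)]
    exact_mod_cast le_antisymm h2 (Nat.cast_nonneg _)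
  have hLorN : ∀ v, v ∉ L → v ∈ N := by
    intro v hv
    by_contra hvN
    have := (hmemE v).2 ⟨hv, hvN⟩
    rw [card_eq_zero.1 hE0] at this
    exact absurd this (notMem_empty _)
  intro a b
  by_cases ha : a ∈ L <;> by_cases hb : b ∈ L
  · simp [ha, hb, hLL a ha b hb]
  · simp [ha, hb, mem_commonNbrs.1 (hLorN b hb) a ha]
  · simp [ha, hb, (mem_commonNbrs.1 (hLorN a ha) b hb).symm]
  · simp only [ha, hb, not_false_eq_true, iff_true, iff_false]
    exact fun hab => hb (hN a (hLorN a ha) b hab)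

/-- A normalised Perron vector. -/
theorem exists_isPerron [DecidableEq V] [Nonempty V] (G : SimpleGraph V) :
    ∃ (r : ℝ) (x : V → ℝ) (z : V), 0 ≤ r ∧ G.IsPerron r x z ∧
      G.adjSpectralRadius = ENNReal.ofReal r := by
  obtain ⟨r, x, hr, hx, hx0, heig, hrad⟩ := G.exists_nonneg_eigenvector
  obtain ⟨z, -, hz⟩ := exists_max_image univ x univ_nonempty
  have hpos : 0 < x z := by
    rcases (hx z).lt_or_eq with h | h
    · exact h
    · exact absurd (funext fun v => le_antisymm (h ▸ hz v (mem_univ v)) (hx v)) hx0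
  refine ⟨r, fun v => x v / x z, z, hr, ⟨fun v => div_nonneg (hx v) hpos.le, fun v => ?_,
    div_self hpos.ne', fun v => ?_⟩, hrad⟩
  · rw [div_le_one hpos]; exact hz v (mem_univ v)
  · rw [← sum_div, heig]; ring

end Structure

/-! ### Complete bipartite graphs. -/

/-- The spectral radius of a complete bipartite graph. -/
theorem IsBicliqueOn.adjSpectralRadius_eq {V : Type*} [Fintype V] [DecidableEq V]
    {G : SimpleGraph V} {L : Finset V} (h : G.IsBicliqueOn L) {k : ℕ} (hk : 1 ≤ k) (hLk : #L = k) :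
    G.adjSpectralRadius = ENNReal.ofReal (Real.sqrt (k * (Fintype.card V - k))) := by
  classical
  have hL : L.Nonempty := card_pos.1 (by omega)
  have hne : Nonempty V := ⟨hL.choose⟩
  have hc : (#Lᶜ : ℝ) = Fintype.card V - k := by
    rw [eq_sub_iff_add_eq, ← hLk]; exact_mod_cast card_compl_add_card L
  have hnb : ∀ v ∈ L, G.neighborFinset v = Lᶜ := by
    intro v hv; ext w; simp [h v w, hv]
  have hnb' : ∀ v, v ∉ L → G.neighborFinset v = L := by
    intro v hv; ext w; simp [h v w, hv]
  have hck : 0 ≤ (Fintype.card V - k : ℝ) := by rw [← hc]; positivity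
  set R := Real.sqrt (k * (Fintype.card V - k)) with hR
  have hR2 : R ^ 2 = k * (Fintype.card V - k) := Real.sq_sqrt (by positivity)
  apply le_antisymm
  · obtain ⟨r, x, hr0, hx, hx0, heig, hrad⟩ := G.exists_nonneg_eigenvector
    rw [hrad]
    refine ENNReal.ofReal_le_ofReal ?_
    have hquad : r * ∑ v, x v ^ 2 = 2 * ((∑ u ∈ L, x u) * ∑ v ∈ Lᶜ, x v) := by
      have h1 : r * ∑ v, x v ^ 2 = ∑ v, x v * ∑ u ∈ G.neighborFinset v, x u := by
        rw [mul_sum]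
        refine sum_congr rfl fun v _ => ?_
        rw [heig]; ring
      have h2 : ∑ v ∈ L, x v * ∑ u ∈ G.neighborFinset v, x u =
          (∑ u ∈ L, x u) * ∑ v ∈ Lᶜ, x v := by
        rw [sum_mul]; exact sum_congr rfl fun v hv => by rw [hnb v hv]
      have h3 : ∑ v ∈ Lᶜ, x v * ∑ u ∈ G.neighborFinset v, x u =
          (∑ u ∈ L, x u) * ∑ v ∈ Lᶜ, x v := by
        rw [mul_comm, sum_mul]
        exact sum_congr rfl fun v hv => by rw [hnb' v (mem_compl.1 hv)]
      rw [h1, ← sum_add_sum_compl L, h2, h3]; ring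
    have hle := two_mul_sum_mul_sum_compl_le hLk x (Real.sqrt_nonneg _) hR2.ge
    rw [← hquad] at hle
    refine le_of_mul_le_mul_right hle ?_
    obtain ⟨v, hv⟩ := Function.ne_iff.1 hx0
    exact sum_pos' (fun _ _ => sq_nonneg _) ⟨v, mem_univ v, by
      have : x v ≠ 0 := hv
      positivity⟩
  -- In this case the claimed radius is 0 and the test vector below, equal to `R` on `L`, would
  -- vanish.
  · by_cases hkn' : (Fintype.card V - k : ℝ) = 0
    · rw [hR, hkn']; simp
    have hkpos : (0 : ℝ) < k := by exact_mod_cast hk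
    refine G.ofReal_le_adjSpectralRadius (Real.sqrt_nonneg _)
      (y := fun v => if v ∈ L then R else k) ?_ ?_
    · intro h0
      obtain ⟨v, hv⟩ := hL
      have := congrFun h0 v
      simp only [hv, if_true, Pi.zero_apply] at this
      rw [this] at hR2
      have : (k : ℝ) * (Fintype.card V - k) ≠ 0 := mul_ne_zero hkpos.ne' hkn'
      apply this; rw [← hR2]; ring
    · intro v
      by_cases hv : v ∈ L
      · rw [hnb v hv, if_pos hv, sum_congr rfl fun w hw => if_neg (mem_compl.1 hw), sum_const,
          nsmul_eq_mul, hc, ← pow_two, hR2]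
        ring
      · rw [hnb' v hv, if_neg hv, sum_congr rfl fun w hw => if_pos hw, sum_const,
          nsmul_eq_mul, hLk]
        ring

theorem isBicliqueOn_iff_nonempty_iso {n k : ℕ} (G : SimpleGraph (Fin n)) :
    (∃ L : Finset (Fin n), #L = k ∧ G.IsBicliqueOn L) ↔
      Nonempty (G ≃g completeBipartiteGraph (Fin k) (Fin (n - k))) := by
  constructor
  · rintro ⟨L, hL, hG⟩
    have h1 : Fintype.card {x // x ∈ L} = k := by simpa using hL
    have h2 : Fintype.card {x // x ∉ L} = n - k := by
      rw [Fintype.card_subtype_compl]; simp [hL]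
    let e : Fin n ≃ Fin k ⊕ Fin (n - k) := (Equiv.sumCompl (· ∈ L)).symm.trans
      (Equiv.sumCongr (Fintype.equivFinOfCardEq h1) (Fintype.equivFinOfCardEq h2))
    have he : ∀ v, (e v).isLeft = decide (v ∈ L) ∧ (e v).isRight = decide (v ∉ L) := by
      intro v
      by_cases hv : v ∈ L
      · simp [e, Equiv.sumCompl_symm_apply_of_pos, hv]
      · simp [e, Equiv.sumCompl_symm_apply_of_neg, hv]
    refine ⟨⟨e, fun {a b} => ?_⟩⟩
    rw [completeBipartiteGraph_adj, hG a b]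
    simp only [he, decide_eq_true_eq]
    tauto
  · rintro ⟨e⟩
    refine ⟨univ.filter fun v => (e v).isLeft, ?_, fun a b => ?_⟩
    · rw [← Fintype.card_subtype]
      calc Fintype.card {v // (e v).isLeft = true}
          = Fintype.card {s : Fin k ⊕ Fin (n - k) // s.isLeft = true} :=
            Fintype.card_congr (e.toEquiv.subtypeEquiv fun _ => Iff.rfl)
        _ = #((univ : Finset (Fin k)).map
            (Function.Embedding.inl : Fin k ↪ Fin k ⊕ Fin (n - k))) := by
            rw [Fintype.card_subtype]
            congr 1
            ext s
            rcases s with s | s <;> simp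
        _ = k := by simp
    · rw [← e.map_adj_iff, completeBipartiteGraph_adj]
      simp only [mem_filter, mem_univ, true_and]
      generalize e a = s
      generalize e b = t
      rcases s with s | s <;> rcases t with t | t <;> simp

/-- The complete bipartite graph with parts `L` and `Lᶜ`. -/
def bicliqueOn {V : Type*} (L : Finset V) : SimpleGraph V where
  Adj a b := a ∈ L ↔ b ∉ L
  symm := ⟨fun a b h => by tauto⟩
  loopless := ⟨fun a h => by tauto⟩

/-! ### Extremal graphs of trees with a pendant cherry. -/

section Main

variable {W : Type*} [Fintype W] {T : SimpleGraph W} {A : Finset W} {v a b u : W}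

/-- Graphs without `T` whose spectral radius is at least that of `K_{k,n-k}`. -/
theorem IsPendantCherry.exists_isBicliqueOn (hc : T.IsPendantCherry v a b u) (hT : T.IsTree)
    (hA : T.IsColourClass A) (hv : v ∉ A) {k : ℕ} (hAk : #A = k + 1) (hk : 1 ≤ k) :
    ∃ n₀ : ℕ, ∀ n, n₀ ≤ n → ∀ G : SimpleGraph (Fin n), T.Free G →
      ENNReal.ofReal (Real.sqrt (k * (n - k))) ≤ G.adjSpectralRadius →
        ∃ L : Finset (Fin n), #L = k ∧ G.IsBicliqueOn L := by
  have hk' : (1 : ℝ) ≤ k := by exact_mod_cast hk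
  have hmk : k + 1 ≤ Fintype.card W := by rw [← hAk]; exact card_le_univ A
  have hmk' : (k : ℝ) + 1 ≤ Fintype.card W := by exact_mod_cast hmk
  have haA : a ∈ A := by by_contra h; exact hv ((hA hc.adj_a).2 h)
  set m : ℝ := (Fintype.card W : ℝ) with hm
  have hm0 : 0 < m := by linarith
  -- Stability leaves out a proportion `δ = k * (2 * θ)`; this choice gives equality in the
  -- smallness condition on `δ` of `IsPerron.isBicliqueOn`.
  set θ : ℝ := 1 / (32 * m * k * (k + 2 * m)) with hθ_def
  have hθ : 0 < θ := by positivity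
  have hθ' : θ * (32 * m * k * (k + 2 * m)) = 1 := by rw [hθ_def]; field_simp
  have hm1 : 1 ≤ m := by linarith
  have hθk : θ * (4 * (k + 1)) ≤ 1 := by
    rw [← hθ']
    refine mul_le_mul_of_nonneg_left ?_ hθ.le
    have h1 : 1 ≤ m * k := one_le_mul_of_one_le_of_one_le hm1 hk'
    have h2 : k + 2 * m ≤ m * k * (k + 2 * m) := le_mul_of_one_le_left (by positivity) h1
    nlinarith
  have hθ2 : θ ≤ 1 / 2 := by nlinarith
  set η' : ℝ := θ / (4 * m) / (16 * m) with hη'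
  have hη0 : 0 < η' := by positivity
  obtain ⟨b', hb⟩ := exists_nat_ge (16 * m ^ 2 / (θ / (4 * m)))
  obtain ⟨n₁, hn₁⟩ := exists_nat_gt (((k : ℝ) ^ 2 + b' * (2 ^ b' * m)) / (θ / 2))
  obtain ⟨n₂, hn₂⟩ := exists_nat_ge (2 * (2 * m / η' ^ 2) ^ 2)
  obtain ⟨n₃, hn₃⟩ := exists_nat_ge (2 * (8 * m * k) ^ 2)
  refine ⟨n₁ + n₂ + n₃ + 2 * Fintype.card W + 1, fun n hn G hfree hrad => ?_⟩
  have hcardV : Fintype.card (Fin n) = n := Fintype.card_fin n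
  have : Nonempty (Fin n) := ⟨⟨0, by omega⟩⟩
  obtain ⟨r, x, z, hr0, hP, hr⟩ := G.exists_isPerron
  have hkn : (2 * k : ℝ) ≤ n := by
    have : 2 * k ≤ n := by omega
    exact_mod_cast this
  have hle : Real.sqrt (k * (n - k)) ≤ r := by
    rw [hr] at hrad
    exact (ENNReal.ofReal_le_ofReal_iff hr0).1 hrad
  have hr2 : (k : ℝ) * (n - k) ≤ r ^ 2 := by
    rw [← Real.sq_sqrt (show 0 ≤ (k : ℝ) * (n - k) by
      apply mul_nonneg <;> linarith)]
    gcongr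
  have hrn : (n : ℝ) / 2 ≤ r ^ 2 := by nlinarith
  have hge : ∀ c : ℝ, ∀ n' : ℕ, 2 * c ^ 2 ≤ n' → n' ≤ n → c ≤ r := by
    intro c n' h1 h2
    have h3 : (n' : ℝ) ≤ n := by exact_mod_cast h2
    exact (abs_le_of_sq_le_sq' (by linarith) hr0).2
  have hr8 : 8 * m * k ≤ r := hge _ n₃ hn₃ (by omega)
  have hrη : 2 * m / η' ^ 2 ≤ r := hge _ n₂ hn₂ (by omega)
  have hrpos : 0 < r := lt_of_lt_of_le (by positivity) hr8
  have hr2' : (k : ℝ) * (Fintype.card (Fin n) - k) ≤ r ^ 2 := by rw [hcardV]; exact hr2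
  have hWn : 2 * Fintype.card W ≤ Fintype.card (Fin n) := by rw [hcardV]; omega
  obtain ⟨L, hL, hxL, hN⟩ := hP.exists_dominating_set hT hfree hA hAk hk hθ hθk hrpos hr2'
    (by omega) (by rwa [div_le_iff₀ (by positivity)] at hrη) hb
    (by
      rw [div_lt_iff₀ (by positivity)] at hn₁
      refine hn₁.trans_le ?_
      rw [hcardV]
      gcongr
      omega) hWn
  have hmN : Fintype.card W ≤ #(G.commonNbrs L) := by
    have h1 : m ≤ #(G.commonNbrs L) := by
      refine le_trans ?_ hN
      have h2 : 2 * m ≤ (Fintype.card (Fin n) : ℝ) := by rw [hm]; exact_mod_cast hWn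
      nlinarith
    rw [hm] at h1
    exact_mod_cast h1
  have hLN : ∀ l ∈ L, ∀ y ∈ G.commonNbrs L, G.Adj l y := fun l hl y hy => mem_commonNbrs.1 hy l hl
  refine ⟨L, hL, hP.isBicliqueOn hT hfree hk hL (fun w hw => by linarith [hxL w hw])
    (fun w hw y hy hwy => hfree (hA.isContained_of_inner_edge hc hv L _ hLN (by omega) hmN hw hy hwy))
    (fun y hy w hyw => ?_) hrpos hr2' (by omega) hN ?_ hr8⟩
  · by_contra hw
    exact hfree (hA.isContained_of_pendant_edge haA hc.adj_a.symm (fun y h => hc.eq_of_adj_a h)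
      L _ hLN (by omega) hmN hw hy hyw.symm)
  · refine le_of_eq ?_
    rw [← hθ']; ring

/-- The spectral extremal graph of a tree with a pendant cherry centred in its larger colour class
is complete bipartite. -/
theorem IsPendantCherry.spexEqCompleteBipartite (hc : T.IsPendantCherry v a b u) (hT : T.IsTree)
    (hA : T.IsColourClass A) (hv : v ∉ A) (hcard : 2 * #A ≤ Fintype.card W) :
    ∃ n₀ : ℕ, ∀ n, n₀ ≤ n → SPEXEqCompleteBipartite n T (#A - 1) := by
  have hmem : ∀ y, T.Adj v y → y ∈ A := fun y hy => by
    by_contra h; exact hv ((hA hy).2 h)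
  have hA2 : 1 < #A := one_lt_card.2 ⟨a, hmem a hc.adj_a, b, hmem b hc.adj_b, hc.a_ne_b⟩
  obtain ⟨k, hAk⟩ : ∃ k, #A = k + 1 := ⟨#A - 1, by omega⟩
  have hk : 1 ≤ k := by omega
  obtain ⟨n₀, hn₀⟩ := hc.exists_isBicliqueOn hT hA hv hAk hk
  refine ⟨n₀ + k, fun n hn => ?_⟩
  rw [hAk, Nat.add_sub_cancel]
  have hkn : k ≤ n := by omega
  have hfree : ∀ G : SimpleGraph (Fin n), ∀ L : Finset (Fin n), #L = k → G.IsBicliqueOn L →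
      T.Free G := fun G L hL hG =>
    hA.free_of_card_lt hT.1 L (by omega) (by omega) fun x y h => (hG x y).1 h
  have hrad : ∀ G : SimpleGraph (Fin n), ∀ L : Finset (Fin n), #L = k → G.IsBicliqueOn L →
      G.adjSpectralRadius = ENNReal.ofReal (Real.sqrt (k * (n - k))) := fun G L hL hG => by
    rw [hG.adjSpectralRadius_eq hk hL, Fintype.card_fin]
  refine ⟨hkn, fun G => ?_⟩
  rw [← isBicliqueOn_iff_nonempty_iso]
  constructor
  · rintro ⟨hGf, hGmax⟩
    obtain ⟨L, -, hL⟩ := exists_subset_card_eq (s := (univ : Finset (Fin n))) (n := k)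
      (by simpa using hkn)
    have hB : (bicliqueOn L).IsBicliqueOn L := fun _ _ => Iff.rfl
    refine hn₀ n (by omega) G hGf ?_
    rw [← hrad _ L hL hB]
    exact hGmax _ (hfree _ L hL hB)
  · rintro ⟨L, hL, hG⟩
    refine ⟨hfree G L hL hG, fun G' hG' => ?_⟩
    rw [hrad G L hL hG]
    -- A `T`-free graph of larger radius would itself be complete bipartite with a part of size `k`,
    -- hence of the same radius.
    by_contra! hlt
    obtain ⟨L', hL', hGL'⟩ := hn₀ n (by omega) G' hG' hlt.le
    exact hlt.ne' (hrad G' L' hL' hGL')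

end Main

end SimpleGraph

/-! ### Rooted trees as parent maps. -/

section ParentMaps

variable {X : Type*} {o : X} {f g : X → X}

/-- `f` sends each vertex of a tree rooted at `o` to its parent, and `o` to itself. -/
structure IsParentMap (o : X) (f : X → X) : Prop where
  root : f o = o
  reach : ∀ x, ∃ n, f^[n] x = o

/-- Induction from the root. -/
theorem IsParentMap.induction (hf : IsParentMap o f) {P : X → Prop} (h0 : P o)
    (hs : ∀ x, x ≠ o → P (f x) → P x) (x : X) : P x := by
  obtain ⟨n, hn⟩ := hf.reach x
  induction n generalizing x with
  | zero => rw [show x = o from hn]; exact h0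
  | succ n ih =>
    by_cases hx : x = o
    · rw [hx]; exact h0
    · exact hs x hx (ih (f x) hn)

/-- For modified parent maps: `R` holds off the moved vertices, and two steps suffice to leave a
moved cherry. -/
theorem IsParentMap.of_step (h0 : g o = o) {R : X → Prop}
    (hR : ∀ x, R x → ∃ n, g^[n] x = o) (h : ∀ x, R x ∨ R (g x) ∨ R (g (g x))) :
    IsParentMap o g := by
  refine ⟨h0, fun x => ?_⟩
  rcases h x with h | h | h
  · exact hR x h
  · obtain ⟨n, hn⟩ := hR _ h
    exact ⟨n + 1, hn⟩
  · obtain ⟨n, hn⟩ := hR _ h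
    exact ⟨n + 2, hn⟩

theorem IsParentMap.apply_ne (hf : IsParentMap o f) {x : X} (hx : x ≠ o) : f x ≠ x := by
  intro h
  obtain ⟨n, hn⟩ := hf.reach x
  rw [Function.iterate_fixed h] at hn
  exact hx hn

theorem IsParentMap.apply_apply_ne (hf : IsParentMap o f) {x : X} (hx : x ≠ o) : f (f x) ≠ x := by
  intro h
  have key : ∀ n, f^[n] x = x ∨ f^[n] x = f x := by
    intro n
    induction n with
    | zero => exact Or.inl rfl
    | succ n ih =>
      rw [Function.iterate_succ_apply']
      rcases ih with ih | ih <;> rw [ih]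
      · exact Or.inr rfl
      · exact Or.inl h
  obtain ⟨n, hn⟩ := hf.reach x
  rcases key n with h' | h'
  · exact hx (h'.symm.trans hn)
  · rw [hn] at h'
    rw [← h', hf.root] at h
    exact hx h.symm

/-- The number of steps from a vertex to the root. -/
noncomputable def parentDepth (o : X) (f : X → X) (x : X) : ℕ := sInf {n | f^[n] x = o}

theorem parentDepth_root : parentDepth o f o = 0 := by
  refine Nat.sInf_eq_zero.2 (Or.inl ?_)
  rfl

theorem IsParentMap.parentDepth_eq (hf : IsParentMap o f) {x : X} (hx : x ≠ o) :
    parentDepth o f x = parentDepth o f (f x) + 1 := by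
  apply le_antisymm
  · refine Nat.sInf_le ?_
    exact Nat.sInf_mem (s := {n | f^[n] (f x) = o}) (hf.reach (f x))
  · have h1 : f^[parentDepth o f x] x = o := Nat.sInf_mem (s := {n | f^[n] x = o}) (hf.reach x)
    obtain ⟨d, hd⟩ : ∃ d, parentDepth o f x = d + 1 := by
      refine Nat.exists_eq_succ_of_ne_zero fun h0 => ?_
      rw [h0] at h1
      exact hx h1
    rw [hd] at h1 ⊢
    exact Nat.succ_le_succ (Nat.sInf_le h1)

/-- The tree with the given parent map. -/
def treeOfParentMap (f : X → X) : SimpleGraph X where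
  Adj x y := x ≠ y ∧ (f x = y ∨ f y = x)
  symm := ⟨fun _ _ h => ⟨h.1.symm, h.2.symm⟩⟩
  loopless := ⟨fun _ h => h.1 rfl⟩

theorem IsParentMap.adj_apply (hf : IsParentMap o f) {x : X} (hx : x ≠ o) :
    (treeOfParentMap f).Adj x (f x) :=
  ⟨(hf.apply_ne hx).symm, Or.inl rfl⟩

theorem IsParentMap.connected (hf : IsParentMap o f) : (treeOfParentMap f).Connected := by
  have h : ∀ x, (treeOfParentMap f).Reachable x o :=
    hf.induction (SimpleGraph.Reachable.refl _) fun x hx ih => (hf.adj_apply hx).reachable.trans ih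
  have : Nonempty X := ⟨o⟩
  exact ⟨fun x y => (h x).trans (h y).symm⟩

theorem IsParentMap.isTree [Finite X] (hf : IsParentMap o f) : (treeOfParentMap f).IsTree := by
  classical
  have := Fintype.ofFinite X
  rw [SimpleGraph.isTree_iff_connected_and_card]
  refine ⟨hf.connected, le_antisymm ?_ hf.connected.card_vert_le_card_edgeSet_add_one⟩
  have hsub : (treeOfParentMap f).edgeSet ⊆
      (((univ : Finset X).erase o).image fun x => s(x, f x) : Finset (Sym2 X)) := by
    intro e
    induction e with
    | _ x y =>
      rw [SimpleGraph.mem_edgeSet]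
      rintro ⟨hne, h⟩
      have key : ∀ x y, x ≠ y → f x = y → s(x, y) ∈
          (((univ : Finset X).erase o).image fun x => s(x, f x) : Finset (Sym2 X)) := by
        rintro x y hne rfl
        refine mem_image.2 ⟨x, mem_erase.2 ⟨?_, mem_univ _⟩, rfl⟩
        rintro rfl
        exact hne hf.root.symm
      rcases h with h | h
      · exact key x y hne h
      · rw [Sym2.eq_swap]
        exact key y x hne.symm h
  have h1 : Nat.card (treeOfParentMap f).edgeSet ≤ #((univ : Finset X).erase o) := by
    rw [Nat.card_coe_set_eq]
    refine (Set.ncard_le_ncard hsub (Finset.finite_toSet _)).trans ?_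
    rw [Set.ncard_coe_finset]
    exact card_image_le
  rw [card_erase_of_mem (mem_univ _), card_univ] at h1
  have h2 : 0 < Fintype.card X := Fintype.card_pos_iff.2 ⟨o⟩
  rw [Nat.card_eq_fintype_card (α := X)]
  omega

/-- Induction from the root: if the edge from `x` to `f x` were directed the other way by `g`,
agreement at `f x` would give `f (f x) = x`. -/
theorem IsParentMap.eq_of_treeOfParentMap_eq (hf : IsParentMap o f) (hg : IsParentMap o g)
    (h : treeOfParentMap f = treeOfParentMap g) : f = g := by
  funext x
  refine hf.induction (P := fun x => f x = g x) (by rw [hf.root, hg.root]) (fun x hx ih => ?_) x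
  have hadj := hf.adj_apply hx
  rw [h] at hadj
  rcases hadj.2 with h1 | h1
  · exact h1.symm
  · exact absurd (ih.trans h1) (hf.apply_apply_ne hx)

/-- Send each vertex to a neighbour nearer to `o`. The resulting connected spanning subgraph is all
of `T`, since a tree is minimally connected. -/
theorem SimpleGraph.IsTree.exists_isParentMap {T : SimpleGraph X} (hT : T.IsTree)
    (o : X) : ∃ f, IsParentMap o f ∧ treeOfParentMap f = T := by
  classical
  have hex : ∀ x, ∃ y, (x = o → y = o) ∧ (x ≠ o → T.Adj x y ∧ T.dist y o < T.dist x o) := by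
    intro x
    by_cases hx : x = o
    · exact ⟨o, fun _ => rfl, fun h => absurd hx h⟩
    · obtain ⟨p, hp⟩ := hT.1.exists_walk_length_eq_dist x o
      cases p with
      | nil => exact absurd rfl hx
      | cons h q =>
        refine ⟨_, fun h => absurd h hx, fun _ => ⟨h, ?_⟩⟩
        rw [← hp, SimpleGraph.Walk.length_cons]
        exact Nat.lt_succ_of_le (SimpleGraph.dist_le q)
  choose f hf1 hf2 using hex
  have hf : IsParentMap o f := by
    refine ⟨hf1 o rfl, fun x => ?_⟩
    induction hd : T.dist x o using Nat.strong_induction_on generalizing x with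
    | _ d ih =>
      by_cases hx : x = o
      · exact ⟨0, hx⟩
      · obtain ⟨n, hn⟩ := ih _ (hd ▸ (hf2 x hx).2) (f x) rfl
        exact ⟨n + 1, hn⟩
  have hle : treeOfParentMap f ≤ T := by
    have key : ∀ x y, x ≠ y → f x = y → T.Adj x y := by
      rintro x y hne rfl
      refine (hf2 x ?_).1
      rintro rfl
      exact hne hf.root.symm
    rintro x y ⟨hne, h | h⟩
    · exact key x y hne h
    · exact (key y x hne.symm h).symm
  exact ⟨f, hf, le_antisymm hle
    ((SimpleGraph.isTree_iff_minimal_connected.1 hT).2 hf.connected hle)⟩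

/-- The vertex `v` has exactly the two children `a` and `b`, and these are leaves. -/
structure IsCherry (f : X → X) (v a b : X) : Prop where
  apply_a : f a = v
  apply_b : f b = v
  ne : a ≠ b
  eq_or_eq : ∀ ⦃x⦄, f x = v → x = a ∨ x = b
  leaf_a : ∀ x, f x ≠ a
  leaf_b : ∀ x, f x ≠ b

/-- The root counts as its own child, so as a centre it would be one of its own childless children.
-/
theorem IsCherry.ne_root {v a b : X} (h : IsCherry f v a b) (hf : IsParentMap o f) : v ≠ o := by
  rintro rfl
  rcases h.eq_or_eq hf.root with h' | h'
  · exact h.leaf_a v (hf.root.trans h')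
  · exact h.leaf_b v (hf.root.trans h')

theorem IsCherry.isPendantCherry {v a b : X} (h : IsCherry f v a b) (hf : IsParentMap o f) :
    (treeOfParentMap f).IsPendantCherry v a b (f v) where
  adj_a := ⟨fun hva => h.leaf_a a (h.apply_a.trans hva), Or.inr h.apply_a⟩
  adj_b := ⟨fun hva => h.leaf_b b (h.apply_b.trans hva), Or.inr h.apply_b⟩
  adj_u := hf.adj_apply (h.ne_root hf)
  a_ne_b := h.ne
  u_ne_a := h.leaf_a v
  u_ne_b := h.leaf_b v
  eq_of_adj_a := by
    rintro y ⟨-, hy | hy⟩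
    · rw [← hy, h.apply_a]
    · exact absurd hy (h.leaf_a y)
  eq_of_adj_b := by
    rintro y ⟨-, hy | hy⟩
    · rw [← hy, h.apply_b]
    · exact absurd hy (h.leaf_b y)
  of_adj_v := by
    rintro y ⟨-, hy | hy⟩
    · exact Or.inr (Or.inr hy.symm)
    · rcases h.eq_or_eq hy with h' | h'
      · exact Or.inl h'
      · exact Or.inr (Or.inl h')

open scoped Classical in
theorem IsParentMap.isColourClass [Fintype X] (hf : IsParentMap o f) :
    (treeOfParentMap f).IsColourClass (univ.filter fun x => Even (parentDepth o f x)) := by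
  have key : ∀ x y, x ≠ y → f x = y →
      (Even (parentDepth o f x) ↔ ¬ Even (parentDepth o f y)) := by
    rintro x y hne rfl
    have hx : x ≠ o := by
      rintro rfl
      exact hne hf.root.symm
    rw [hf.parentDepth_eq hx, Nat.even_add_one]
  rintro x y ⟨hne, h | h⟩
  · simpa using key x y hne h
  · have := key y x hne.symm h
    simp only [mem_filter, mem_univ, true_and]
    tauto

/-- A tree with pendant cherries centred in both colour classes is good. -/
theorem IsParentMap.mem_goodLabelledTrees {m : ℕ} {o : Fin m} {f : Fin m → Fin m}
    (hf : IsParentMap o f) {v a b v' a' b' : Fin m} (h : IsCherry f v a b)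
    (hv : Even (parentDepth o f v)) (h' : IsCherry f v' a' b')
    (hv' : ¬ Even (parentDepth o f v')) : treeOfParentMap f ∈ goodLabelledTrees m := by
  classical
  have hcol := hf.isColourClass
  set A := univ.filter fun x => Even (parentDepth o f x) with hA
  refine ⟨hf.isTree, ?_⟩
  -- The class with at most half of the vertices is used, together with the cherry centred in the
  -- other class.
  by_cases hc : 2 * #A ≤ Fintype.card (Fin m)
  · exact ⟨_, (h'.isPendantCherry hf).spexEqCompleteBipartite hf.isTree hcol
      (by simpa [hA] using hv') hc⟩
  · have hcol' : (treeOfParentMap f).IsColourClass Aᶜ := by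
      intro x y hxy
      have := hcol hxy
      simp only [mem_compl]
      tauto
    refine ⟨_, (h.isPendantCherry hf).spexEqCompleteBipartite hf.isTree hcol' (by simpa [hA]) ?_⟩
    have := card_compl_add_card A
    omega

end ParentMaps

/-! ### Replanting vertices with at most one child. -/

section Moves

open scoped Classical

variable {X : Type*} {o : X} {f : X → X}

/-- The vertex `v` has at most one child. -/
def IsLow (f : X → X) (v : X) : Prop := ∀ ⦃x y⦄, f x = v → f y = v → x = y

/-- Suppress the vertex `v`, handing its children to its parent, and reattach it as a child
of `u`. -/
noncomputable def reattach (f : X → X) (v u : X) : X → X :=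
  fun x => if x = v then u else if f x = v then f v else f x

theorem reattach_self (f : X → X) (v u : X) : reattach f v u v = u := by simp [reattach]

theorem reattach_of_ne {v u x : X} (hx : x ≠ v) (hfx : f x ≠ v) : reattach f v u x = f x := by
  simp [reattach, hx, hfx]

theorem reattach_of_child {v u x : X} (hx : x ≠ v) (hfx : f x = v) :
    reattach f v u x = f v := by
  simp [reattach, hx, hfx]

theorem reattach_ne {v u : X} (hu : u ≠ v) (hv : f v ≠ v) (x : X) : reattach f v u x ≠ v := by
  by_cases hx : x = v
  · rw [hx, reattach_self]; exact hu
  · by_cases hfx : f x = v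
    · rw [reattach_of_child hx hfx]; exact hv
    · rw [reattach_of_ne hx hfx]; exact hfx

theorem IsParentMap.reattach (hf : IsParentMap o f) {v u : X} (hv : v ≠ o) (hu : u ≠ v) :
    IsParentMap o (reattach f v u) := by
  have hfv := hf.apply_ne hv
  -- The new orbits bypass `v`, so at `v` the induction carries the claim for `f v` instead.
  have key : ∀ x, (x = v → ∃ n, (_root_.reattach f v u)^[n] (f v) = o) ∧
      (x ≠ v → ∃ n, (_root_.reattach f v u)^[n] x = o) := by
    refine hf.induction ⟨fun h => absurd h.symm hv, fun _ => ⟨0, rfl⟩⟩ fun x hx ih => ?_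
    refine ⟨?_, fun hxv => ?_⟩
    · rintro rfl
      exact ih.2 hfv
    · by_cases hfx : f x = v
      · obtain ⟨n, hn⟩ := ih.1 hfx
        exact ⟨n + 1, by rwa [Function.iterate_succ_apply, reattach_of_child hxv hfx]⟩
      · obtain ⟨n, hn⟩ := ih.2 hfx
        exact ⟨n + 1, by rwa [Function.iterate_succ_apply, reattach_of_ne hxv hfx]⟩
  refine IsParentMap.of_step (R := fun x => x ≠ v) ?_ (fun x => (key x).2) fun x => ?_
  · rw [reattach_of_ne hv.symm (by rw [hf.root]; exact hv.symm), hf.root]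
  · by_cases hx : x = v
    · right; left
      rw [hx, reattach_self]; exact hu
    · exact Or.inl hx

/-- Only the old parent of `v` can gain children besides `u`, and it exchanges its only child `v`
for the at most one child of `v`. -/
theorem IsLow.reattach {v u w : X} (hw : IsLow f w) (hv : IsLow f v) (hwu : w ≠ u) :
    IsLow (reattach f v u) w := by
  have key : ∀ x, _root_.reattach f v u x = w →
      (f v ≠ w ∧ f x = w) ∨ (f v = w ∧ f x = v) := by
    intro x hx
    by_cases hxv : x = v
    · rw [hxv, reattach_self] at hx
      exact absurd hx.symm hwu
    · by_cases hfx : f x = v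
      · rw [reattach_of_child hxv hfx] at hx
        exact Or.inr ⟨hx, hfx⟩
      · rw [reattach_of_ne hxv hfx] at hx
        refine Or.inl ⟨fun h => hxv (hw hx h), hx⟩
  intro x y hx hy
  rcases key x hx with ⟨h1, h2⟩ | ⟨h1, h2⟩ <;> rcases key y hy with ⟨h3, h4⟩ | ⟨h3, h4⟩
  · exact hw h2 h4
  · exact absurd h3 h1
  · exact absurd h1 h3
  · exact hv h2 h4

/-- The data needed to undo the reattachment of a vertex with at most one child. -/
noncomputable def reattachCode (f : X → X) (v : X) : X ⊕ X :=
  if h : ∃ c, f c = v then Sum.inr h.choose else Sum.inl (f v)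

/-- Undo a reattachment. -/
noncomputable def undoReattach (g : X → X) (v : X) : X ⊕ X → X → X
  | Sum.inl p => Function.update g v p
  | Sum.inr c => Function.update (Function.update g v (g c)) c v

/-- If `v` had a child `c`, it was the only one and now hangs from the old parent of `v`, so `c`
alone determines that parent. Otherwise the parent itself is recorded. -/
theorem undoReattach_reattach {v u : X} (hv : IsLow f v) (hfv : f v ≠ v) :
    undoReattach (reattach f v u) v (reattachCode f v) = f := by
  funext x
  by_cases h : ∃ c, f c = v
  · have hc := h.choose_spec
    have hcode : reattachCode f v = Sum.inr h.choose := by simp [reattachCode, h]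
    rw [hcode]
    set c := h.choose
    have hcv : c ≠ v := by
      intro hcv; rw [hcv] at hc; exact hfv hc
    simp only [undoReattach]
    by_cases hxc : x = c
    · rw [hxc, Function.update_self, hc]
    · rw [Function.update_of_ne hxc]
      by_cases hxv : x = v
      · rw [hxv, Function.update_self, reattach_of_child hcv hc]
      · rw [Function.update_of_ne hxv]
        exact reattach_of_ne hxv fun hfx => hxc (hv hfx hc)
  · have hcode : reattachCode f v = Sum.inl (f v) := by simp [reattachCode, h]
    rw [hcode]
    simp only [undoReattach]
    by_cases hxv : x = v
    · rw [hxv, Function.update_self]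
    · rw [Function.update_of_ne hxv]
      exact reattach_of_ne hxv fun hfx => h ⟨x, hfx⟩

variable [Fintype X]

/-- The centres of the cherries. -/
noncomputable def cherryCentres (f : X → X) : Finset X :=
  univ.filter fun v => ∃ a b, IsCherry f v a b

theorem mem_cherryCentres {v : X} : v ∈ cherryCentres f ↔ ∃ a b, IsCherry f v a b := by
  simp [cherryCentres]

/-- Children change only at `v`, `f v` and `u`. The vertex `f (f v)` may become a centre because `f
v` may turn into a leaf. -/
theorem cherryCentres_reattach_subset (f : X → X) (v u : X) :
    cherryCentres (reattach f v u) ⊆ cherryCentres f ∪ {v, f v, u, f (f v)} := by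
  intro w hw
  obtain ⟨a, b, h⟩ := mem_cherryCentres.1 hw
  rw [mem_union, or_iff_not_imp_right]
  intro hns
  simp only [mem_insert, mem_singleton, not_or] at hns
  obtain ⟨h1, h2, h3, h4⟩ := hns
  have key : ∀ x, reattach f v u x = w → f x = w ∧ x ≠ v := by
    intro x hx
    by_cases hxv : x = v
    · rw [hxv, reattach_self] at hx
      exact absurd hx.symm h3
    · by_cases hfx : f x = v
      · rw [reattach_of_child hxv hfx] at hx
        exact absurd hx.symm h2
      · rw [reattach_of_ne hxv hfx] at hx
        exact ⟨hx, hxv⟩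
  have leaf : ∀ c, reattach f v u c = w → (∀ x, reattach f v u x ≠ c) → ∀ x, f x ≠ c := by
    intro c hc hl x hx
    by_cases hxv : x = v
    · rw [hxv] at hx
      apply h4
      rw [hx, (key c hc).1]
    · by_cases hfx : f x = v
      · exact (key c hc).2 (hx.symm.trans hfx)
      · exact hl x (by rw [reattach_of_ne hxv hfx, hx])
  refine mem_cherryCentres.2 ⟨a, b, (key a h.apply_a).1, (key b h.apply_b).1, h.ne,
    fun x hx => h.eq_or_eq ?_, leaf a h.apply_a h.leaf_a, leaf b h.apply_b h.leaf_b⟩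
  rw [reattach_of_ne _ (by rw [hx]; exact h1), hx]
  rintro rfl
  exact h2 hx.symm

theorem card_cherryCentres_reattach_le (f : X → X) (v u : X) :
    #(cherryCentres (reattach f v u)) ≤ #(cherryCentres f) + 4 := by
  refine (card_le_card (cherryCentres_reattach_subset f v u)).trans ?_
  refine (card_union_le _ _).trans (Nat.add_le_add_left card_le_four _)

/-- Build a cherry out of the low vertices `v`, `a`, `b` at the vertex `u`. -/
noncomputable def plantCherry (f : X → X) (v a b u : X) : X → X :=
  reattach (reattach (reattach f v u) a v) b v

omit [Fintype X] in
theorem plantCherry_isCherry (hf : IsParentMap o f) {v a b u : X} (hv : v ≠ o) (ha : a ≠ o)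
    (hb : b ≠ o) (hva : v ≠ a) (hvb : v ≠ b) (hab : a ≠ b) (huv : u ≠ v) :
    IsParentMap o (plantCherry f v a b u) ∧ IsCherry (plantCherry f v a b u) v a b := by
  have hf1 := hf.reattach hv huv
  have hl1 : ∀ x, reattach f v u x ≠ v := reattach_ne huv (hf.apply_ne hv)
  set f1 := reattach f v u
  have hf2 := hf1.reattach ha hva
  have hl2 : ∀ x, reattach f1 a v x ≠ a := reattach_ne hva (hf1.apply_ne ha)
  have hc2 : ∀ x, reattach f1 a v x = v → x = a := by
    intro x hx
    by_contra hxa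
    by_cases hfx : f1 x = a
    · rw [reattach_of_child hxa hfx] at hx
      exact hl1 a hx
    · rw [reattach_of_ne hxa hfx] at hx
      exact hl1 x hx
  have hs2 : reattach f1 a v a = v := reattach_self _ _ _
  set f2 := reattach f1 a v
  have hf3 := hf2.reattach hb hvb
  refine ⟨hf3, ?_, reattach_self _ _ _, hab, fun x hx => ?_, fun x hx => ?_,
    reattach_ne hvb (hf2.apply_ne hb)⟩
  · change reattach f2 b v a = v
    rw [reattach_of_ne hab (by rw [hs2]; exact hvb), hs2]
  · change reattach f2 b v x = v at hx
    by_cases hxb : x = b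
    · exact Or.inr hxb
    · left
      by_cases hfx : f2 x = b
      · rw [reattach_of_child hxb hfx] at hx
        exact absurd (hc2 b hx) hab.symm
      · rw [reattach_of_ne hxb hfx] at hx
        exact hc2 x hx
  · change reattach f2 b v x = a at hx
    by_cases hxb : x = b
    · rw [hxb, reattach_self] at hx
      exact hva hx
    · by_cases hfx : f2 x = b
      · rw [reattach_of_child hxb hfx] at hx
        exact hl2 b hx
      · rw [reattach_of_ne hxb hfx] at hx
        exact hl2 x hx

theorem card_cherryCentres_plantCherry_le (f : X → X) (v a b u : X) :
    #(cherryCentres (plantCherry f v a b u)) ≤ #(cherryCentres f) + 12 := by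
  have h1 := card_cherryCentres_reattach_le f v u
  have h2 := card_cherryCentres_reattach_le (reattach f v u) a v
  have h3 := card_cherryCentres_reattach_le (reattach (reattach f v u) a v) b v
  change #(cherryCentres (reattach (reattach (reattach f v u) a v) b v)) ≤ _
  omega

/-- The data needed to undo `plantCherry`. -/
noncomputable def plantCode (f : X → X) (v a b u : X) : (X ⊕ X) × (X ⊕ X) × (X ⊕ X) :=
  (reattachCode f v, reattachCode (reattach f v u) a,
    reattachCode (reattach (reattach f v u) a v) b)

-- The three moves are undone in reverse order. Avoiding `v`, `a`, `b`, the target `u` keeps the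
-- vertices low at each stage; it is read off as the parent of `v` after the first move.
omit [Fintype X] in
theorem plantCherry_injective {f g : X → X} (hf : IsParentMap o f) (hg : IsParentMap o g)
    {v a b u u' : X} (hv : v ≠ o) (ha : a ≠ o) (hb : b ≠ o) (hva : v ≠ a) (hvb : v ≠ b)
    (huv : u ≠ v) (hua : u ≠ a) (hub : u ≠ b) (huv' : u' ≠ v) (hua' : u' ≠ a)
    (hub' : u' ≠ b) (hfv : IsLow f v) (hfa : IsLow f a) (hfb : IsLow f b) (hgv : IsLow g v)
    (hga : IsLow g a) (hgb : IsLow g b)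
    (h : plantCherry f v a b u = plantCherry g v a b u')
    (hcode : plantCode f v a b u = plantCode g v a b u') : f = g ∧ u = u' := by
  have key : ∀ (f : X → X) (u : X), IsParentMap o f → u ≠ v → u ≠ a → u ≠ b → IsLow f v →
      IsLow f a → IsLow f b →
      undoReattach (plantCherry f v a b u) b (plantCode f v a b u).2.2 =
        reattach (reattach f v u) a v ∧
      undoReattach (reattach (reattach f v u) a v) a (plantCode f v a b u).2.1 =
        reattach f v u ∧
      undoReattach (reattach f v u) v (plantCode f v a b u).1 = f := by
    intro f u hf huv hua hub hfv hfa hfb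
    have hf1 := hf.reattach hv huv
    have hf2 := hf1.reattach ha hva
    have ha1 : IsLow (reattach f v u) a := hfa.reattach hfv hua.symm
    have hb1 : IsLow (reattach f v u) b := hfb.reattach hfv hub.symm
    exact ⟨undoReattach_reattach (hb1.reattach ha1 hvb.symm) (hf2.apply_ne hb),
      undoReattach_reattach ha1 (hf1.apply_ne ha), undoReattach_reattach hfv (hf.apply_ne hv)⟩
  obtain ⟨k1, k2, k3⟩ := key f u hf huv hua hub hfv hfa hfb
  obtain ⟨l1, l2, l3⟩ := key g u' hg huv' hua' hub' hgv hga hgb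
  rw [h, hcode, l1] at k1
  rw [← k1, hcode, l2] at k2
  rw [← k2, hcode, l3] at k3
  refine ⟨k3.symm, ?_⟩
  have := congrFun k2 v
  rw [reattach_self, reattach_self] at this
  exact this.symm

/-- The numbers of children sum to `Fintype.card X`, so at most half of the vertices have two or
more. -/
theorem card_le_two_mul_card_isLow (f : X → X) :
    Fintype.card X ≤ 2 * #(univ.filter (IsLow f)) := by
  have h1 : Fintype.card X = ∑ v, #(univ.filter fun x => f x = v) := by
    rw [← card_univ]
    exact card_eq_sum_card_fiberwise fun x _ => mem_univ (f x)
  have h2 : 2 * #(univ.filter fun v => ¬ IsLow f v) ≤ Fintype.card X := by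
    rw [h1]
    calc 2 * #(univ.filter fun v => ¬ IsLow f v)
        = ∑ v ∈ univ.filter fun v => ¬ IsLow f v, 2 := by rw [sum_const, smul_eq_mul, mul_comm]
      _ ≤ ∑ v ∈ univ.filter fun v => ¬ IsLow f v, #(univ.filter fun x => f x = v) := by
          refine sum_le_sum fun v hv => ?_
          have hv := (mem_filter.1 hv).2
          simp only [IsLow] at hv
          push Not at hv
          obtain ⟨x, y, hx, hy, hxy⟩ := hv
          exact one_lt_card.2 ⟨x, by simpa using hx, y, by simpa using hy, hxy⟩
      _ ≤ _ := sum_le_sum_of_subset (subset_univ _)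
  have h3 : #(univ.filter (IsLow f)) + #(univ.filter fun v => ¬ IsLow f v) = Fintype.card X := by
    rw [card_filter_add_card_filter_not, card_univ]
  omega

end Moves

/-! ### Trees with few cherries. -/

section Counting

open scoped Classical

variable {X : Type*} {o : X} {f : X → X} [Fintype X]

/-- The triples `(v, a, b)` that form a cherry. -/
noncomputable def cherryTriples (f : X → X) : Finset (X × X × X) :=
  univ.filter fun t => IsCherry f t.1 t.2.1 t.2.2

theorem card_cherryTriples_le (f : X → X) : #(cherryTriples f) ≤ 4 * #(cherryCentres f) := by
  have himg : (cherryTriples f).image Prod.fst ⊆ cherryCentres f := by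
    intro v hv
    obtain ⟨t, ht, rfl⟩ := mem_image.1 hv
    exact mem_cherryCentres.2 ⟨_, _, (mem_filter.1 ht).2⟩
  refine (card_le_mul_card_image (f := Prod.fst) (cherryTriples f) 4 fun v hv => ?_).trans
    (Nat.mul_le_mul_left _ (card_le_card himg))
  obtain ⟨a, b, h⟩ := mem_cherryCentres.1 (himg hv)
  have hsub : (cherryTriples f).filter (fun t => t.1 = v) ⊆
      ({v} : Finset X) ×ˢ (({a, b} : Finset X) ×ˢ ({a, b} : Finset X)) := by
    rintro ⟨v', a', b'⟩ ht
    simp only [mem_filter, cherryTriples, mem_univ, true_and] at ht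
    obtain ⟨h', rfl⟩ := ht
    simp only [mem_product, mem_singleton, mem_insert, true_and]
    exact ⟨h.eq_or_eq h'.apply_a, h.eq_or_eq h'.apply_b⟩
  refine (card_le_card hsub).trans ?_
  rw [card_product, card_product, card_singleton]
  have : #({a, b} : Finset X) ≤ 2 := card_le_two
  nlinarith

theorem Finset.card_mul_le_card_sigma {α : Type*} {β : α → Type*} (S : Finset α)
    (R : ∀ a, Finset (β a)) (q : ℕ) (h : ∀ a ∈ S, q ≤ #(R a)) : #S * q ≤ #(S.sigma R) := by
  rw [card_sigma, ← smul_eq_mul]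
  exact card_nsmul_le_sum S _ q h

/-- The vertices other than the root with at most one child. -/
noncomputable def lowVertices [DecidableEq X] (o : X) (f : X → X) : Finset X := (univ.filter (IsLow f)).erase o

theorem mem_lowVertices [DecidableEq X] {v : X} : v ∈ lowVertices o f ↔ v ≠ o ∧ IsLow f v := by
  simp [lowVertices]

/-- The parent maps of trees rooted at `o`. -/
noncomputable def parentMaps [DecidableEq X] (o : X) : Finset (X → X) :=
  univ.filter (IsParentMap o)

theorem mem_parentMaps [DecidableEq X] : f ∈ parentMaps o ↔ IsParentMap o f := by
  simp [parentMaps]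

/-- Few trees have few cherries. -/
theorem card_few_cherries_mul_le [DecidableEq X] (o : X) (τ q : ℕ)
    (hq : 2 * (q + 3) ≤ Fintype.card X) :
    #((parentMaps o).filter fun f => #(cherryCentres f) < τ) * q ^ 4 ≤
      #(parentMaps o) * (4 * (τ + 12) * (2 * Fintype.card X) ^ 3) := by
  set S := (parentMaps o).filter fun f => #(cherryCentres f) < τ with hS
  -- Choices `(f, v, a, b, u)` of a planting: at least `q` options at each of the four stages.
  let D : Finset (Σ _ : X → X, Σ _ : X, Σ _ : X, Σ _ : X, X) :=
    S.sigma fun f => (lowVertices o f).sigma fun v => ((lowVertices o f).erase v).sigma fun a =>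
      (((lowVertices o f).erase v).erase a).sigma fun b => ((univ.erase v).erase a).erase b
  -- Outcomes: a tree, a cherry in it, and the undo data. As `(v, a, b)` is now a visible cherry, it
  -- costs `O(τ)` rather than `m^3`; this is the gain.
  let E : Finset ((Σ _ : X → X, X × X × X) × ((X ⊕ X) × (X ⊕ X) × (X ⊕ X))) :=
    (((parentMaps o).filter fun f => #(cherryCentres f) ≤ τ + 12).sigma fun f =>
      cherryTriples f) ×ˢ univ
  have hlow : ∀ f : X → X, q + 2 ≤ #(lowVertices o f) := by
    intro f
    have h1 := card_le_two_mul_card_isLow f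
    have h2 : #(univ.filter (IsLow f)) - 1 ≤ #(lowVertices o f) := pred_card_le_card_erase
    omega
  have hD : #S * q ^ 4 ≤ #D := by
    have hpow : q ^ 4 = q * (q * (q * q)) := by ring
    rw [hpow]
    refine card_mul_le_card_sigma _ _ _ fun f _ => ?_
    have hf := hlow f
    have hv := fun v => pred_card_le_card_erase (s := lowVertices o f) (a := v)
    have ha := fun v a => pred_card_le_card_erase (s := (lowVertices o f).erase v) (a := a)
    refine le_trans (Nat.mul_le_mul_right _ (show q ≤ #(lowVertices o f) by omega)) ?_
    refine card_mul_le_card_sigma _ _ _ fun v _ => ?_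
    refine le_trans (Nat.mul_le_mul_right _
      (show q ≤ #((lowVertices o f).erase v) by have := hv v; omega)) ?_
    refine card_mul_le_card_sigma _ _ _ fun a _ => ?_
    refine le_trans (Nat.mul_le_mul_right _
      (show q ≤ #(((lowVertices o f).erase v).erase a) by have := hv v; have := ha v a; omega)) ?_
    refine card_mul_le_card_sigma _ _ _ fun b _ => ?_
    have h1 := pred_card_le_card_erase (s := (univ : Finset X)) (a := v)
    have h2 := pred_card_le_card_erase (s := (univ : Finset X).erase v) (a := a)
    have h3 := pred_card_le_card_erase (s := ((univ : Finset X).erase v).erase a) (a := b)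
    rw [card_univ] at h1
    omega
  have hE : #E ≤ #(parentMaps o) * (4 * (τ + 12) * (2 * Fintype.card X) ^ 3) := by
    simp only [E, card_product, card_sigma, card_univ, Fintype.card_prod, Fintype.card_sum]
    rw [← mul_assoc #(parentMaps o)]
    refine Nat.mul_le_mul ?_ (le_of_eq (by ring))
    calc ∑ f ∈ (parentMaps o).filter fun f => #(cherryCentres f) ≤ τ + 12, #(cherryTriples f)
        ≤ ∑ f ∈ (parentMaps o).filter fun f => #(cherryCentres f) ≤ τ + 12, 4 * (τ + 12) :=
          sum_le_sum fun f hf => (card_cherryTriples_le f).trans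
            (Nat.mul_le_mul_left _ (mem_filter.1 hf).2)
      _ ≤ _ := by
          rw [sum_const, smul_eq_mul]
          exact Nat.mul_le_mul_right _ (card_filter_le _ _)
  refine hD.trans (le_trans ?_ hE)
  have hmem : ∀ {f v a b u}, (⟨f, v, a, b, u⟩ : Σ _ : X → X, Σ _ : X, Σ _ : X, Σ _ : X, X) ∈ D →
      (IsParentMap o f ∧ #(cherryCentres f) < τ) ∧ (v ≠ o ∧ a ≠ o ∧ b ≠ o) ∧
      (IsLow f v ∧ IsLow f a ∧ IsLow f b) ∧ (v ≠ a ∧ v ≠ b ∧ a ≠ b) ∧ u ≠ v ∧ u ≠ a ∧ u ≠ b := by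
    intro f v a b u h
    simp only [D, hS, mem_sigma, mem_filter, mem_parentMaps, mem_erase, mem_lowVertices,
      mem_univ, and_true] at h
    obtain ⟨hf, ⟨hvo, hv⟩, ⟨hav, hao, ha⟩, ⟨hba, hbv, hbo, hb⟩, hub, hua, huv⟩ := h
    exact ⟨hf, ⟨hvo, hao, hbo⟩, ⟨hv, ha, hb⟩, ⟨hav.symm, hbv.symm, hba.symm⟩, huv, hua, hub⟩
  refine card_le_card_of_injOn
    (fun t => (⟨plantCherry t.1 t.2.1 t.2.2.1 t.2.2.2.1 t.2.2.2.2,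
      (t.2.1, t.2.2.1, t.2.2.2.1)⟩, plantCode t.1 t.2.1 t.2.2.1 t.2.2.2.1 t.2.2.2.2)) ?_ ?_
  · rintro ⟨f, v, a, b, u⟩ ht
    obtain ⟨⟨hf, hfc⟩, ⟨hv, ha, hb⟩, -, ⟨hva, hvb, hab⟩, huv, -, -⟩ := hmem ht
    obtain ⟨h1, h2⟩ := plantCherry_isCherry hf hv ha hb hva hvb hab huv
    have h3 := card_cherryCentres_plantCherry_le f v a b u
    simp only [E, coe_product, Set.mem_prod, mem_coe, mem_sigma, mem_filter, mem_parentMaps,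
      cherryTriples, mem_univ, true_and, and_true]
    exact ⟨⟨h1, by omega⟩, h2⟩
  · rintro ⟨f, v, a, b, u⟩ ht ⟨f', v', a', b', u'⟩ ht' heq
    obtain ⟨⟨hf, -⟩, ⟨hv, ha, hb⟩, ⟨lv, la, lb⟩, ⟨hva, hvb, -⟩, huv, hua, hub⟩ := hmem ht
    obtain ⟨⟨hf', -⟩, -, ⟨lv', la', lb'⟩, -, huv', hua', hub'⟩ := hmem ht'
    simp only [Prod.mk.injEq, Sigma.mk.injEq, heq_eq_eq] at heq
    obtain ⟨⟨h1, rfl, rfl, rfl⟩, h2⟩ := heq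
    obtain ⟨rfl, rfl⟩ := plantCherry_injective hf hf' hv ha hb hva hvb huv hua hub huv' hua' hub'
      lv la lb lv' la' lb' h1 h2
    rfl


end Counting

/-! ### Trees whose cherries all have the same parity. -/

section Redirect

variable {X : Type*} [DecidableEq X] {o : X} {f : X → X} {v a b u : X}

omit [DecidableEq X] in
theorem IsCherry.a_ne (h : IsCherry f v a b) : a ≠ v := fun e => h.leaf_a a (h.apply_a.trans e.symm)

omit [DecidableEq X] in
theorem IsCherry.b_ne (h : IsCherry f v a b) : b ≠ v := fun e => h.leaf_b b (h.apply_b.trans e.symm)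

omit [DecidableEq X] in
/-- Properties pass to a map in which a cherry has been moved, off the cherry. -/
theorem IsCherry.induction_off (h : IsCherry f v a b) (hf : IsParentMap o f) {P : X → Prop}
    (h0 : P o) (hs : ∀ x, x ≠ o → x ≠ v → P (f x) → P x) {x : X}
    (hx : x ≠ v ∧ x ≠ a ∧ x ≠ b) : P x := by
  refine hf.induction (P := fun x => (x ≠ v ∧ x ≠ a ∧ x ≠ b) → P x) (fun _ => h0)
    (fun x hxo ih hx => hs x hxo hx.1 (ih ⟨fun hfx => ?_, h.leaf_a x, h.leaf_b x⟩)) x hx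
  rcases h.eq_or_eq hfx with h' | h'
  · exact hx.2.1 h'
  · exact hx.2.2 h'

/-- Moving a cherry to another parent. -/
theorem IsCherry.isParentMap_update (h : IsCherry f v a b) (hf : IsParentMap o f)
    (hu : u ≠ v ∧ u ≠ a ∧ u ≠ b) : IsParentMap o (Function.update f v u) := by
  have hvo := h.ne_root hf
  -- Paths to the root that start off the cherry never enter it, so the update does not affect them.
  refine IsParentMap.of_step (R := fun x => x ≠ v ∧ x ≠ a ∧ x ≠ b) ?_ ?_ fun x => ?_
  · rw [Function.update_of_ne hvo.symm, hf.root]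
  · intro x hx
    refine h.induction_off hf (P := fun x => ∃ n, (Function.update f v u)^[n] x = o) ⟨0, rfl⟩
      (fun x _ hxv ih => ?_) hx
    obtain ⟨n, hn⟩ := ih
    exact ⟨n + 1, by rwa [Function.iterate_succ_apply, Function.update_of_ne hxv]⟩
  · by_cases hxv : x = v
    · right; left
      rw [hxv, Function.update_self]; exact hu
    by_cases hxa : x = a
    · right; right
      rw [hxa, Function.update_of_ne h.a_ne, h.apply_a, Function.update_self]; exact hu
    by_cases hxb : x = b
    · right; right
      rw [hxb, Function.update_of_ne h.b_ne, h.apply_b, Function.update_self]; exact hu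
    exact Or.inl ⟨hxv, hxa, hxb⟩

theorem IsCherry.update (h : IsCherry f v a b) (hu : u ≠ v ∧ u ≠ a ∧ u ≠ b) :
    IsCherry (Function.update f v u) v a b := by
  refine ⟨?_, ?_, h.ne, fun x hx => ?_, fun x hx => ?_, fun x hx => ?_⟩
  · rw [Function.update_of_ne h.a_ne, h.apply_a]
  · rw [Function.update_of_ne h.b_ne, h.apply_b]
  all_goals by_cases hxv : x = v
  any_goals rw [Function.update_of_ne hxv] at hx
  any_goals rw [hxv, Function.update_self] at hx
  · exact absurd hx hu.1
  · exact h.eq_or_eq hx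
  · exact hu.2.1 hx
  · exact h.leaf_a x hx
  · exact hu.2.2 hx
  · exact h.leaf_b x hx

theorem IsCherry.parentDepth_update_of_ne (h : IsCherry f v a b) (hf : IsParentMap o f)
    (hu : u ≠ v ∧ u ≠ a ∧ u ≠ b) {x : X} (hx : x ≠ v ∧ x ≠ a ∧ x ≠ b) :
    parentDepth o (Function.update f v u) x = parentDepth o f x := by
  have hf' := h.isParentMap_update hf hu
  refine h.induction_off hf
    (P := fun x => parentDepth o (Function.update f v u) x = parentDepth o f x)
    (by rw [parentDepth_root, parentDepth_root]) (fun x hxo hxv ih => ?_) hx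
  rw [hf'.parentDepth_eq hxo, hf.parentDepth_eq hxo, Function.update_of_ne hxv, ih]

theorem IsCherry.parentDepth_update_self (h : IsCherry f v a b) (hf : IsParentMap o f)
    (hu : u ≠ v ∧ u ≠ a ∧ u ≠ b) :
    parentDepth o (Function.update f v u) v = parentDepth o f u + 1 := by
  rw [(h.isParentMap_update hf hu).parentDepth_eq (h.ne_root hf), Function.update_self,
    h.parentDepth_update_of_ne hf hu hu]

theorem cherryCentres_update_subset [Fintype X] (f : X → X) (v u : X) :
    cherryCentres (Function.update f v u) ⊆ cherryCentres f ∪ {v, f v, u, f (f v)} := by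
  intro w hw
  obtain ⟨a, b, h⟩ := mem_cherryCentres.1 hw
  rw [mem_union, or_iff_not_imp_right]
  intro hns
  simp only [mem_insert, mem_singleton, not_or] at hns
  obtain ⟨h1, h2, h3, h4⟩ := hns
  have key : ∀ x, Function.update f v u x = w → f x = w := by
    intro x hx
    by_cases hxv : x = v
    · rw [hxv, Function.update_self] at hx
      exact absurd hx.symm h3
    · rwa [Function.update_of_ne hxv] at hx
  have leaf : ∀ c, Function.update f v u c = w → (∀ x, Function.update f v u x ≠ c) →
      ∀ x, f x ≠ c := by
    intro c hc hl x hx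
    by_cases hxv : x = v
    · rw [hxv] at hx
      apply h4
      rw [hx, key c hc]
    · exact hl x (by rw [Function.update_of_ne hxv, hx])
  refine mem_cherryCentres.2 ⟨a, b, key a h.apply_a, key b h.apply_b, h.ne,
    fun x hx => h.eq_or_eq ?_, leaf a h.apply_a h.leaf_a, leaf b h.apply_b h.leaf_b⟩
  rw [Function.update_of_ne _, hx]
  rintro rfl
  exact h2 hx.symm

open scoped Classical in
/-- The centres of cherries at depth of parity opposite to `c`. -/
noncomputable def oppositeCentres [Fintype X] (o : X) (c : Prop) (f : X → X) : Finset X :=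
  (cherryCentres f).filter fun v => ¬ (Even (parentDepth o f v) ↔ c)

omit [DecidableEq X] in
theorem mem_oppositeCentres [Fintype X] {c : Prop} {w : X} : w ∈ oppositeCentres o c f ↔
    w ∈ cherryCentres f ∧ ¬ (Even (parentDepth o f w) ↔ c) := by
  simp only [oppositeCentres, mem_filter]

-- The leaves `a` and `b` are one level below `v`, so a vertex of the parity of `v` is neither of
-- them.
omit [DecidableEq X] in
theorem IsCherry.ne_of_even_iff {c : Prop} (h : IsCherry f v a b) (hf : IsParentMap o f)
    (hc : Even (parentDepth o f v) ↔ c) (huv : u ≠ v) (hu : Even (parentDepth o f u) ↔ c) :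
    u ≠ v ∧ u ≠ a ∧ u ≠ b := by
  refine ⟨huv, ?_, ?_⟩
  · rintro rfl
    rw [hf.parentDepth_eq (fun e => h.leaf_a o (hf.root.trans e.symm)), h.apply_a,
      Nat.even_add_one] at hu
    tauto
  · rintro rfl
    rw [hf.parentDepth_eq (fun e => h.leaf_b o (hf.root.trans e.symm)), h.apply_b,
      Nat.even_add_one] at hu
    tauto

theorem IsCherry.oppositeCentres_update [Fintype X] {c : Prop} (h : IsCherry f v a b)
    (hf : IsParentMap o f) (hall : ∀ w ∈ cherryCentres f, Even (parentDepth o f w) ↔ c)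
    (huv : u ≠ v) (hu : Even (parentDepth o f u) ↔ c) :
    v ∈ oppositeCentres o c (Function.update f v u) ∧
      #(oppositeCentres o c (Function.update f v u)) ≤ 4 := by
  have hv := hall v (mem_cherryCentres.2 ⟨a, b, h⟩)
  have hu' := h.ne_of_even_iff hf hv huv hu
  have h' := h.update hu'
  constructor
  · refine mem_oppositeCentres.2 ⟨mem_cherryCentres.2 ⟨a, b, h'⟩, ?_⟩
    rw [h.parentDepth_update_self hf hu', Nat.even_add_one]
    tauto
  -- Any other centre was a centre before the move and lies off the cherry, so its depth is
  -- unchanged and still has the parity `c`.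
  · refine le_trans (card_le_card (t := {v, f v, u, f (f v)}) fun w hw => ?_) card_le_four
    rw [mem_oppositeCentres] at hw
    by_contra hns
    have hwf := (mem_union.1 (cherryCentres_update_subset f v u hw.1)).resolve_right hns
    obtain ⟨a₁, b₁, h₁⟩ := mem_cherryCentres.1 hw.1
    have hw' : w ≠ v ∧ w ≠ a ∧ w ≠ b := by
      refine ⟨?_, ?_, ?_⟩
      · rintro rfl
        simp at hns
      · rintro rfl
        exact h'.leaf_a _ h₁.apply_a
      · rintro rfl
        exact h'.leaf_b _ h₁.apply_a
    apply hw.2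
    rw [h.parentDepth_update_of_ne hf hu' hw']
    exact hall w hwf

open scoped Classical in
/-- Few trees have many cherries, all centred in the same colour class. -/
theorem card_monochromatic_mul_le [Fintype X] (o : X) (τ : ℕ) (c : Prop) :
    #((parentMaps o).filter fun f => τ ≤ #(cherryCentres f) ∧
      ∀ w ∈ cherryCentres f, (Even (parentDepth o f w) ↔ c)) * (τ * (τ - 1)) ≤
      #(parentMaps o) * (4 * Fintype.card X) := by
  set S := (parentMaps o).filter fun f => τ ≤ #(cherryCentres f) ∧
      ∀ w ∈ cherryCentres f, (Even (parentDepth o f w) ↔ c) with hS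
  let D : Finset (Σ _ : X → X, Σ _ : X, X) :=
    S.sigma fun f => (cherryCentres f).sigma fun v =>
      (univ.filter fun u => Even (parentDepth o f u) ↔ c).erase v
  -- The new tree, the moved centre (one of at most four of the new parity) and its old parent.
  let E : Finset ((Σ _ : X → X, X) × X) :=
    (((parentMaps o).filter fun f => #(oppositeCentres o c f) ≤ 4).sigma fun f =>
      oppositeCentres o c f) ×ˢ univ
  have hmemS : ∀ {f}, f ∈ S → IsParentMap o f ∧ τ ≤ #(cherryCentres f) ∧
      ∀ w ∈ cherryCentres f, (Even (parentDepth o f w) ↔ c) := by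
    intro f hf
    rw [hS, mem_filter, mem_parentMaps] at hf
    exact hf
  have hD : #S * (τ * (τ - 1)) ≤ #D := by
    refine card_mul_le_card_sigma _ _ _ fun f hf => ?_
    obtain ⟨-, hτ, hall⟩ := hmemS hf
    refine le_trans (Nat.mul_le_mul_right _ hτ) ?_
    refine card_mul_le_card_sigma _ _ _ fun v _ => ?_
    have h1 := pred_card_le_card_erase
      (s := univ.filter fun u => Even (parentDepth o f u) ↔ c) (a := v)
    -- The centres themselves have the parity `c`, which supplies enough new parents.
    have h2 : #(cherryCentres f) ≤ #(univ.filter fun u => Even (parentDepth o f u) ↔ c) :=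
      card_le_card fun w hw => mem_filter.2 ⟨mem_univ _, hall w hw⟩
    omega
  have hE : #E ≤ #(parentMaps o) * (4 * Fintype.card X) := by
    simp only [E, card_product, card_sigma, card_univ]
    rw [← mul_assoc]
    refine Nat.mul_le_mul_right _ ?_
    calc ∑ f ∈ (parentMaps o).filter fun f => #(oppositeCentres o c f) ≤ 4,
          #(oppositeCentres o c f)
        ≤ ∑ f ∈ (parentMaps o).filter fun f => #(oppositeCentres o c f) ≤ 4, 4 :=
          sum_le_sum fun f hf => (mem_filter.1 hf).2
      _ ≤ _ := by
          rw [sum_const, smul_eq_mul]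
          exact Nat.mul_le_mul_right _ (card_filter_le _ _)
  refine hD.trans (le_trans ?_ hE)
  have hmem : ∀ {f v u}, (⟨f, v, u⟩ : Σ _ : X → X, Σ _ : X, X) ∈ D →
      f ∈ S ∧ v ∈ cherryCentres f ∧ u ≠ v ∧ (Even (parentDepth o f u) ↔ c) := by
    intro f v u h
    simp only [D, mem_sigma, mem_erase, mem_filter, mem_univ, true_and] at h
    exact h
  refine card_le_card_of_injOn (fun t => (⟨Function.update t.1 t.2.1 t.2.2, t.2.1⟩, t.1 t.2.1)) ?_ ?_
  · rintro ⟨f, v, u⟩ ht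
    obtain ⟨hf, hv, huv, hu⟩ := hmem ht
    obtain ⟨hf, -, hall⟩ := hmemS hf
    have hvc := hall v hv
    obtain ⟨a, b, h⟩ := mem_cherryCentres.1 hv
    obtain ⟨h1, h2⟩ := h.oppositeCentres_update hf hall huv hu
    simp only [E, coe_product, Set.mem_prod, mem_coe, mem_sigma, mem_filter, mem_parentMaps,
      mem_univ, and_true]
    exact ⟨⟨h.isParentMap_update hf (h.ne_of_even_iff hf hvc huv hu), h2⟩, h1⟩
  · rintro ⟨f, v, u⟩ ht ⟨f', v', u'⟩ ht' heq
    simp only [Prod.mk.injEq, Sigma.mk.injEq, heq_eq_eq] at heq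
    obtain ⟨⟨h1, rfl⟩, h2⟩ := heq
    obtain rfl : u = u' := by simpa using congrFun h1 v
    have : f = f' := by
      have h3 := congrArg (fun g => Function.update g v (f v)) h1
      rw [h2] at h3
      simp only [Function.update_idem, Function.update_eq_self] at h3
      rw [← h2, Function.update_eq_self] at h3
      exact h3
    subst this
    rfl

end Redirect

/-! ### Assembling the estimates. -/

section Limit

open scoped Classical

theorem ncard_labelledTrees {m : ℕ} (o : Fin m) : (labelledTrees m).ncard = #(parentMaps o) := by
  have h : labelledTrees m = treeOfParentMap '' (parentMaps o : Set (Fin m → Fin m)) := by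
    ext T
    constructor
    · intro hT
      obtain ⟨f, hf, hfT⟩ := SimpleGraph.IsTree.exists_isParentMap (T := T) hT o
      exact ⟨f, mem_parentMaps.2 hf, hfT⟩
    · rintro ⟨f, hf, rfl⟩
      exact (mem_parentMaps.1 hf).isTree
  rw [h, Set.InjOn.ncard_image, Set.ncard_coe_finset]
  intro f hf g hg hfg
  exact (mem_parentMaps.1 hf).eq_of_treeOfParentMap_eq (mem_parentMaps.1 hg) hfg

/-- A tree with at least `τ` cherries that is monochromatic in neither parity has centres of both
parities, hence is good. -/
theorem card_parentMaps_le {m : ℕ} (o : Fin m) (τ : ℕ) :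
    #(parentMaps o) ≤ (goodLabelledTrees m).ncard +
      #((parentMaps o).filter fun f => #(cherryCentres f) < τ) +
      #((parentMaps o).filter fun f => τ ≤ #(cherryCentres f) ∧
        ∀ w ∈ cherryCentres f, (Even (parentDepth o f w) ↔ True)) +
      #((parentMaps o).filter fun f => τ ≤ #(cherryCentres f) ∧
        ∀ w ∈ cherryCentres f, (Even (parentDepth o f w) ↔ False)) := by
  set S := (parentMaps o).filter fun f => #(cherryCentres f) < τ with hS
  set S₁ := (parentMaps o).filter fun f => τ ≤ #(cherryCentres f) ∧
    ∀ w ∈ cherryCentres f, (Even (parentDepth o f w) ↔ True) with hS₁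
  set S₂ := (parentMaps o).filter fun f => τ ≤ #(cherryCentres f) ∧
    ∀ w ∈ cherryCentres f, (Even (parentDepth o f w) ↔ False) with hS₂
  set R := (parentMaps o).filter fun f => treeOfParentMap f ∈ goodLabelledTrees m with hR
  have hR' : #R ≤ (goodLabelledTrees m).ncard := by
    rw [← Set.ncard_coe_finset]
    refine Set.ncard_le_ncard_of_injOn treeOfParentMap (fun f hf => ?_) (fun f hf g hg hfg => ?_)
      (Set.toFinite _)
    · exact (mem_filter.1 hf).2
    · exact (mem_parentMaps.1 (mem_filter.1 hf).1).eq_of_treeOfParentMap_eq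
        (mem_parentMaps.1 (mem_filter.1 hg).1) hfg
  have hsub : parentMaps o ⊆ R ∪ S ∪ S₁ ∪ S₂ := by
    intro f hf
    simp only [mem_union, hR, hS, hS₁, hS₂, mem_filter, hf, true_and, iff_true, iff_false]
    by_contra hcon
    push Not at hcon
    obtain ⟨⟨⟨h0, h1⟩, h2⟩, h3⟩ := hcon
    obtain ⟨w, hw, hw'⟩ := h2 h1
    obtain ⟨w', hw1, hw2⟩ := h3 h1
    obtain ⟨a, b, h⟩ := mem_cherryCentres.1 hw
    obtain ⟨a', b', h'⟩ := mem_cherryCentres.1 hw1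
    exact h0 ((mem_parentMaps.1 hf).mem_goodLabelledTrees h' hw2 h hw')
  refine (card_le_card hsub).trans ?_
  have h1 := card_union_le (R ∪ S ∪ S₁) S₂
  have h2 := card_union_le (R ∪ S) S₁
  have h3 := card_union_le R S
  omega

theorem ncard_goodLabelledTrees_ge {ε : ℝ} (hε : 0 < ε) :
    ∃ m₀ : ℕ, ∀ m, m₀ ≤ m → 0 < ((labelledTrees m).ncard : ℝ) ∧
      (1 - ε) * (labelledTrees m).ncard ≤ (goodLabelledTrees m).ncard := by
  -- With `q = m / 4 ≥ m / 8` and `τ + 12 ≤ 2m / K`, trees with few cherries have proportion at most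
  -- `262144 / K ≤ ε / 2`.
  obtain ⟨K, hK⟩ := exists_nat_ge (524288 / ε + 1)
  have hK0 : (0 : ℝ) < K := lt_of_lt_of_le (by positivity) hK
  have hKε : 524288 ≤ ε * K := by
    have : 524288 / ε ≤ K := by linarith
    rwa [div_le_iff₀' hε] at this
  -- Each monochromatic family has proportion at most `16 * K ^ 2 / m ≤ ε / 4`.
  obtain ⟨M, hM⟩ := exists_nat_ge (64 * (K : ℝ) ^ 2 / ε)
  refine ⟨M + 12 * K + 16, fun m hm => ?_⟩
  have o : Fin m := ⟨0, by omega⟩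
  rw [ncard_labelledTrees o]
  have hle := card_parentMaps_le o (m / K)
  have hfew := card_few_cherries_mul_le o (m / K) (m / 4) (by rw [Fintype.card_fin]; omega)
  have hmono₁ := card_monochromatic_mul_le o (m / K) True
  have hmono₂ := card_monochromatic_mul_le o (m / K) False
  rw [Fintype.card_fin] at hfew hmono₁ hmono₂
  have hF : 0 < #(parentMaps o) := by
    -- The star centred at `o`.
    obtain ⟨f, hf⟩ : ∃ f, IsParentMap o f :=
      ⟨fun _ => o, rfl, fun x => ⟨1, rfl⟩⟩
    exact card_pos.2 ⟨f, mem_parentMaps.2 hf⟩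
  set F := #(parentMaps o)
  set few := #((parentMaps o).filter fun f => #(cherryCentres f) < m / K)
  set mono₁ := #((parentMaps o).filter fun f => m / K ≤ #(cherryCentres f) ∧
        ∀ w ∈ cherryCentres f, (Even (parentDepth o f w) ↔ True))
  set mono₂ := #((parentMaps o).filter fun f => m / K ≤ #(cherryCentres f) ∧
        ∀ w ∈ cherryCentres f, (Even (parentDepth o f w) ↔ False))
  have hKpos : 0 < K := by exact_mod_cast hK0
  have hm' : (M : ℝ) + 12 * K + 16 ≤ m := by exact_mod_cast hm
  have hM0 : (0 : ℝ) ≤ M := Nat.cast_nonneg M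
  have hm0 : (0 : ℝ) < m := by linarith
  have hF' : (0 : ℝ) < F := by exact_mod_cast hF
  have hq : (m : ℝ) / 8 ≤ ((m / 4 : ℕ) : ℝ) := by
    rw [div_le_iff₀ (by norm_num)]
    have : m ≤ m / 4 * 8 := by omega
    exact_mod_cast this
  have hτ : ((m / K : ℕ) : ℝ) + 12 ≤ 2 * m / K := by
    have h1 : ((m / K : ℕ) : ℝ) ≤ m / K := Nat.cast_div_le
    have h2 : (12 : ℝ) ≤ m / K := by rw [le_div_iff₀ hK0]; linarith
    calc ((m / K : ℕ) : ℝ) + 12 ≤ m / K + m / K := add_le_add h1 h2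
      _ = _ := by ring
  have hτ' : (m : ℝ) / (2 * K) ≤ ((m / K - 1 : ℕ) : ℝ) := by
    have h1 : (m : ℝ) / K < ((m / K : ℕ) : ℝ) + 1 := by
      rw [div_lt_iff₀ hK0]
      have := Nat.lt_mul_div_succ m hKpos
      have h2 : m < (m / K + 1) * K := by rw [mul_comm]; exact this
      exact_mod_cast h2
    have h2 : 1 ≤ m / K := (Nat.one_le_div_iff hKpos).2 (by omega)
    rw [Nat.cast_sub h2, Nat.cast_one]
    have h3 : (4 : ℝ) ≤ m / K := by rw [le_div_iff₀ hK0]; linarith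
    have h4 : (m : ℝ) / (2 * K) = m / K / 2 := by field_simp
    rw [h4]; linarith
  have hfew' : (few : ℝ) ≤ ε / 2 * F := by
    have h1 : (few : ℝ) * (m / 4 : ℕ) ^ 4 ≤ F * (4 * ((m / K : ℕ) + 12) * (2 * m) ^ 3) := by
      exact_mod_cast hfew
    have h2 : (few : ℝ) * ((m : ℝ) / 8) ^ 4 ≤ F * (4 * (2 * m / K) * (2 * m) ^ 3) := by
      refine le_trans ?_ (h1.trans ?_) <;> gcongr
    have h3 : (few : ℝ) * m ^ 4 ≤ (262144 / K * F) * m ^ 4 := by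
      have h4 : (262144 / K * F) * (m : ℝ) ^ 4 =
          8 ^ 4 * (F * (4 * (2 * m / K) * (2 * m) ^ 3)) := by
        field_simp; norm_num
      rw [h4]
      linarith
    have h5 := le_of_mul_le_mul_right h3 (by positivity)
    refine h5.trans (mul_le_mul_of_nonneg_right ?_ hF'.le)
    rw [div_le_iff₀ hK0]; linarith
  have hmono' : ∀ mono : ℕ, mono * (m / K * (m / K - 1)) ≤ F * (4 * m) →
      (mono : ℝ) ≤ ε / 4 * F := by
    intro mono hmono
    have h1 : (mono : ℝ) * ((m / K : ℕ) * (m / K - 1 : ℕ)) ≤ F * (4 * m) := by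
      exact_mod_cast hmono
    have h2 : (mono : ℝ) * (m / (2 * K) * (m / (2 * K))) ≤ F * (4 * m) := by
      refine le_trans ?_ h1
      have : ((m / K - 1 : ℕ) : ℝ) ≤ ((m / K : ℕ) : ℝ) := by exact_mod_cast Nat.sub_le _ _
      gcongr
      exact hτ'.trans this
    have h3 : (mono : ℝ) * m * m ≤ (16 * K ^ 2 * F) * m := by
      have h4 : (mono : ℝ) * m * m = 4 * K ^ 2 * (mono * (m / (2 * K) * (m / (2 * K)))) := by
        field_simp; norm_num
      rw [h4]
      nlinarith [mul_le_mul_of_nonneg_left h2 (show (0 : ℝ) ≤ 4 * K ^ 2 by positivity)]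
    have h5 : (mono : ℝ) * m ≤ 16 * K ^ 2 * F := le_of_mul_le_mul_right h3 hm0
    have h6 : 64 * (K : ℝ) ^ 2 ≤ ε * m := by
      have : 64 * (K : ℝ) ^ 2 / ε ≤ m := by linarith
      rwa [div_le_iff₀' hε] at this
    refine le_of_mul_le_mul_right (h5.trans ?_) hm0
    nlinarith
  have h₁ := hmono' mono₁ (by convert hmono₁)
  have h₂ := hmono' mono₂ (by convert hmono₂)
  have hle' : (F : ℝ) ≤ (goodLabelledTrees m).ncard + few + mono₁ + mono₂ := by
    exact_mod_cast hle
  exact ⟨hF', by linarith⟩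

end Limit

theorem proposition1p4 :
    Filter.Tendsto
      (fun m : ℕ => ((goodLabelledTrees m).ncard : ℝ) / ((labelledTrees m).ncard : ℝ))
      Filter.atTop (nhds 1) := by
  rw [Metric.tendsto_atTop]
  intro ε hε
  obtain ⟨m₀, hm₀⟩ := ncard_goodLabelledTrees_ge (half_pos hε)
  refine ⟨m₀, fun m hm => ?_⟩
  obtain ⟨hpos, hge⟩ := hm₀ m hm
  have hle : (goodLabelledTrees m).ncard ≤ (labelledTrees m).ncard :=
    Set.ncard_le_ncard (fun T hT => hT.1) (Set.toFinite _)
  have h1 : ((goodLabelledTrees m).ncard : ℝ) / (labelledTrees m).ncard ≤ 1 := by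
    rw [div_le_one hpos]; exact_mod_cast hle
  have h2 : 1 - ε / 2 ≤ ((goodLabelledTrees m).ncard : ℝ) / (labelledTrees m).ncard := by
    rwa [le_div_iff₀ hpos]
  rw [Real.dist_eq, abs_lt]
  constructor <;> linarith
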